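/- Let $U\subset\mathbb C^n$ be an open neighbourhood of $x_0=0$ with coordinates $x=(x_1,\dots,x_n)$, and let $F,G$ be holomorphic functions on $U$ whose germs at $0$ are coprime in the ring $\mathcal O_0$ of germs of holomorphic functions at $0$. Assume that there are a weight vector $w=(w_1,\dots,w_n)\in\mathbb Z_{\ge 0}^n\setminus\{0\}$ and integers $d_1,d_2>0$ with $d_1\neq d_2$ such that the vector field $v=\sum_i w_ix_i\partial_{x_i}$ satisfies $vF=d_1F$ and $vG=d_2G$ on $U$; thus $f=F/G$ is quasi-homogeneous of degree $d_1-d_2\ne 0$. (In particular $F(0)=G(0)=0$.) Assume moreover that the hypersurface $f^{-1}(0)=F^{-1}(0)\setminus G^{-1}(0)$ of $U\setminus G^{-1}(0)$ defined by $f$ is smooth, i.e. $df(x)\neq 0$ for all $x\in U$ with $F(x)=0$ and $G(x)\neq 0$. For $p\in U$ let $\widetilde{\mathcal D}_p=\mathcal D_p[1/G]$, where $\mathcal D_p$ is the ring of germs at $p$ of linear differential operators with holomorphic coefficients. The ring $\widetilde{\mathcal D}_p[s]$ acts on the free module $\mathcal L_p=\mathcal O_p[\tfrac1{FG}][s]\,f^s$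 by $\partial_{x_i}(a(s)f^s)=\bigl(\partial_{x_i}a(s)+s\,a(s)\,\tfrac{\partial_{x_i}f}{f}\bigr)f^s$, and $f^{s+1}$ denotes $f\cdot f^s\in\mathcal L_p$. Let $f_i=\partial f/\partial x_i$ and let $\widetilde{\mathcal R}$ be the module with stalks $$\widetilde{\mathcal R}_p=\widetilde{\mathcal D}_p f^s\Big/\sum_{i=1}^n\widetilde{\mathcal D}_p f_if^s .$$ For $m\ge 0$ let the reduced $b$-function $\tilde b^{\rm mero}_{f,m}(s)\in\mathbb C[s]$ of $f$ of order $m$ (at $0$) be the monic polynomial $b(s)\ne0$ of least degree for which there is $P(s)\in\widetilde{\mathcal D}_0[s]$ with $$b(s)\Bigl(\tfrac1{G^m}f^s\Bigr)=P(s)\Bigl(\tfrac1{G^m}f^{s+1}\Bigr)\quad\text{in }\mathcal L_0 .$$ Then $\widetilde{\mathcal R}_p=0$ for every $p\in U$, i.e. $\widetilde{\mathcal R}=0$; and for every $m\ge 0$ the reduced $b$-function $\tilde b^{\rm mero}_{f,m}(s)$ exists and equals $s+1$, i.e. $\tilde b^{\rm mero}_f(s)=s+1$. -/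

import Mathlib

open scoped Topology Polynomial

noncomputable section

namespace MeroBFun

/-! ### Germs of holomorphic functions on `ℂⁿ` -/

/-- The local ring `𝒪_p` of germs at `p ∈ ℂⁿ` of holomorphic (i.e. complex analytic) functions. -/
def HolGerm (n : ℕ) (p : Fin n → ℂ) : Subring (Filter.Germ (𝓝 p) ℂ) where
  carrier := {φ | ∃ g : (Fin n → ℂ) → ℂ, AnalyticAt ℂ g p ∧ (g : Filter.Germ (𝓝 p) ℂ) = φ}
  mul_mem' := by
    rintro _ _ ⟨g, hg, rfl⟩ ⟨h, hh, rfl⟩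
    exact ⟨g * h, hg.mul hh, rfl⟩
  one_mem' := ⟨1, analyticAt_const, rfl⟩
  add_mem' := by
    rintro _ _ ⟨g, hg, rfl⟩ ⟨h, hh, rfl⟩
    exact ⟨g + h, hg.add hh, rfl⟩
  zero_mem' := ⟨0, analyticAt_const, rfl⟩
  neg_mem' := by
    rintro _ ⟨g, hg, rfl⟩
    exact ⟨-g, hg.neg, rfl⟩

variable {n : ℕ} {p : Fin n → ℂ}

/-- The germ at `p` of a function which is holomorphic at `p`. -/
def germAt (g : (Fin n → ℂ) → ℂ) (hg : AnalyticAt ℂ g p) : HolGerm n p :=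
  ⟨(g : Filter.Germ (𝓝 p) ℂ), g, hg, rfl⟩

/-- Constants as germs. -/
def constHom (n : ℕ) (p : Fin n → ℂ) : ℂ →+* HolGerm n p where
  toFun c := germAt (fun _ => c) analyticAt_const
  map_one' := rfl
  map_mul' _ _ := rfl
  map_zero' := rfl
  map_add' _ _ := rfl

instance : Algebra ℂ (HolGerm n p) := (constHom n p).toAlgebra

theorem germAt_surjective (φ : HolGerm n p) :
    ∃ (g : (Fin n → ℂ) → ℂ) (hg : AnalyticAt ℂ g p), germAt g hg = φ := by
  obtain ⟨φ, g, hg, rfl⟩ := φ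
  exact ⟨g, hg, rfl⟩

/-- The partial derivative `∂g/∂x_i` of a function on `ℂⁿ`. -/
def partialDeriv (i : Fin n) (g : (Fin n → ℂ) → ℂ) : (Fin n → ℂ) → ℂ :=
  fun x => fderiv ℂ g x (Pi.single i 1)

theorem analyticAt_partialDeriv (i : Fin n) {g : (Fin n → ℂ) → ℂ} (hg : AnalyticAt ℂ g p) :
    AnalyticAt ℂ (partialDeriv i g) p :=
  ((ContinuousLinearMap.apply ℂ ℂ (Pi.single i (1 : ℂ) : Fin n → ℂ)).analyticAt _).comp hg.fderiv

/-- The partial derivative of a germ. -/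
def germPartialFun (i : Fin n) (φ : HolGerm n p) : HolGerm n p :=
  ⟨Filter.Germ.map' (partialDeriv i)
      (fun _ _ h => (h.fderiv (𝕜 := ℂ)).mono fun x hx => by simp [partialDeriv, hx]) φ.1, by
    obtain ⟨φ, g, hg, rfl⟩ := φ
    exact ⟨partialDeriv i g, analyticAt_partialDeriv i hg, rfl⟩⟩

theorem germPartialFun_germAt (i : Fin n) {g : (Fin n → ℂ) → ℂ} (hg : AnalyticAt ℂ g p) :
    germPartialFun i (germAt g hg) = germAt (partialDeriv i g) (analyticAt_partialDeriv i hg) :=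
  rfl

theorem germAt_congr {g h : (Fin n → ℂ) → ℂ} (hg : AnalyticAt ℂ g p) (hh : AnalyticAt ℂ h p)
    (e : g =ᶠ[𝓝 p] h) : germAt g hg = germAt h hh :=
  Subtype.ext (Filter.Germ.coe_eq.2 e)

/-- The partial derivative `∂_i` as a `ℂ`-linear derivation of `𝒪_p`. -/
def germPartial (n : ℕ) (p : Fin n → ℂ) (i : Fin n) :
    Derivation ℂ (HolGerm n p) (HolGerm n p) :=
  Derivation.mk'
    { toFun := germPartialFun i
      map_add' := by
        intro φ ψ
        obtain ⟨g, hg, rfl⟩ := germAt_surjective φ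
        obtain ⟨h, hh, rfl⟩ := germAt_surjective ψ
        refine germAt_congr (analyticAt_partialDeriv i (hg.add hh))
          ((analyticAt_partialDeriv i hg).add (analyticAt_partialDeriv i hh)) ?_
        filter_upwards [hg.eventually_analyticAt, hh.eventually_analyticAt] with x hx hx'
        simp [partialDeriv, fderiv_add hx.differentiableAt hx'.differentiableAt]
      map_smul' := by
        intro c φ
        obtain ⟨g, hg, rfl⟩ := germAt_surjective φ
        refine germAt_congr (analyticAt_partialDeriv i (analyticAt_const.mul hg))
          (analyticAt_const.mul (analyticAt_partialDeriv i hg)) ?_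
        filter_upwards [hg.eventually_analyticAt] with x hx
        change fderiv ℂ (fun y => c * g y) x (Pi.single i 1) = c * fderiv ℂ g x (Pi.single i 1)
        rw [fderiv_const_mul hx.differentiableAt]
        rfl }
    (by
      intro φ ψ
      obtain ⟨g, hg, rfl⟩ := germAt_surjective φ
      obtain ⟨h, hh, rfl⟩ := germAt_surjective ψ
      refine germAt_congr (analyticAt_partialDeriv i (hg.mul hh))
        ((hg.mul (analyticAt_partialDeriv i hh)).add
          (hh.mul (analyticAt_partialDeriv i hg))) ?_
      filter_upwards [hg.eventually_analyticAt, hh.eventually_analyticAt] with x hx hx'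
      simp [partialDeriv, fderiv_mul hx.differentiableAt hx'.differentiableAt])

theorem germPartial_germAt (i : Fin n) {g : (Fin n → ℂ) → ℂ} (hg : AnalyticAt ℂ g p) :
    germPartial n p i (germAt g hg) =
      germAt (partialDeriv i g) (analyticAt_partialDeriv i hg) :=
  rfl

/-! ### Extension of a derivation to a localization, by the quotient rule -/

section Localization

variable {A : Type} [CommRing A] [Algebra ℂ A] (x : A) (d : Derivation ℂ A A)

/-- The ring homomorphism `a ↦ a + ε d(a)` from `A` to the dual numbers over `A[1/x]`. -/
def dualHom : A →+* TrivSqZeroExt (Localization.Away x) (Localization.Away x) where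
  toFun a := TrivSqZeroExt.inl (algebraMap A (Localization.Away x) a) +
    TrivSqZeroExt.inr (algebraMap A (Localization.Away x) (d a))
  map_one' := by ext <;> simp
  map_mul' a b := by
    ext
    · simp
    · simp only [TrivSqZeroExt.snd_add, TrivSqZeroExt.snd_inl, TrivSqZeroExt.snd_inr,
        TrivSqZeroExt.snd_mul, TrivSqZeroExt.fst_add, TrivSqZeroExt.fst_inl,
        TrivSqZeroExt.fst_inr, Derivation.leibniz, smul_eq_mul, map_add, map_mul, zero_add,
        add_zero, op_smul_eq_smul]
  map_zero' := by ext <;> simp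
  map_add' a b := by
    ext
    · simp
    · simp only [TrivSqZeroExt.snd_add, TrivSqZeroExt.snd_inl, TrivSqZeroExt.snd_inr,
        map_add, zero_add]

theorem isUnit_dualHom : IsUnit (dualHom x d x) := by
  rw [TrivSqZeroExt.isUnit_iff_isUnit_fst]
  simpa [dualHom] using IsLocalization.Away.algebraMap_isUnit (S := Localization.Away x) x

/-- The extension of `dualHom` to the localization. -/
def dualHomLoc :
    Localization.Away x →+* TrivSqZeroExt (Localization.Away x) (Localization.Away x) :=
  IsLocalization.Away.lift x (isUnit_dualHom x d)

theorem dualHomLoc_algebraMap (a : A) :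
    dualHomLoc x d (algebraMap A (Localization.Away x) a) = dualHom x d a :=
  IsLocalization.Away.lift_eq x (isUnit_dualHom x d) a

theorem fst_dualHomLoc (b : Localization.Away x) : (dualHomLoc x d b).fst = b := by
  have h : ((TrivSqZeroExt.fstHom ℂ (Localization.Away x) (Localization.Away x)).toRingHom.comp
      (dualHomLoc x d)) = RingHom.id _ := by
    apply IsLocalization.ringHom_ext (Submonoid.powers x)
    ext a
    simp [dualHomLoc_algebraMap, dualHom]
  exact congrArg (fun φ => φ b) h

/-- The unique derivation of `A[1/x]` extending the derivation `d` of `A`. -/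
def locDerivation : Derivation ℂ (Localization.Away x) (Localization.Away x) :=
  Derivation.mk'
    { toFun := fun b => (dualHomLoc x d b).snd
      map_add' := by simp
      map_smul' := by
        intro c b
        rw [Algebra.smul_def, IsScalarTower.algebraMap_apply ℂ A (Localization.Away x), map_mul,
          dualHomLoc_algebraMap]
        simp [dualHom, fst_dualHomLoc, Algebra.smul_def,
          IsScalarTower.algebraMap_apply ℂ A (Localization.Away x)] }
    (by
      intro a b
      simp [fst_dualHomLoc, mul_comm])

theorem locDerivation_algebraMap (a : A) :
    locDerivation x d (algebraMap A (Localization.Away x) a) =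
      algebraMap A (Localization.Away x) (d a) := by
  change (dualHomLoc x d (algebraMap A (Localization.Away x) a)).snd = _
  rw [dualHomLoc_algebraMap]
  simp only [dualHom, RingHom.coe_mk, MonoidHom.coe_mk, OneHom.coe_mk, TrivSqZeroExt.snd_add,
    TrivSqZeroExt.snd_inl, TrivSqZeroExt.snd_inr, zero_add]

end Localization

/-! ### The meromorphic function `f = F / G` and the module `𝒪[1/(FG)][s] f^s` -/

variable (F G : HolGerm n p)

/-- The stalk `𝒪_p[1/(FG)]`. -/
abbrev Mero : Type := Localization.Away (F * G)

/-- `1 / (FG)` in `𝒪_p[1/(FG)]`. -/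
def invFG : Mero F G := IsLocalization.Away.invSelf (F * G)

/-- `1 / G = F · 1/(FG)` in `𝒪_p[1/(FG)]`. -/
def invG : Mero F G := algebraMap (HolGerm n p) (Mero F G) F * invFG F G

/-- `1 / F = G · 1/(FG)` in `𝒪_p[1/(FG)]`. -/
def invF : Mero F G := algebraMap (HolGerm n p) (Mero F G) G * invFG F G

theorem G_mul_invG : algebraMap (HolGerm n p) (Mero F G) G * invG F G = 1 := by
  have h : algebraMap (HolGerm n p) (Mero F G) (F * G) * invFG F G = 1 :=
    IsLocalization.Away.mul_invSelf (F * G)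
  rw [← h, invG, map_mul]
  ring

theorem F_mul_invF : algebraMap (HolGerm n p) (Mero F G) F * invF F G = 1 := by
  have h : algebraMap (HolGerm n p) (Mero F G) (F * G) * invFG F G = 1 :=
    IsLocalization.Away.mul_invSelf (F * G)
  rw [← h, invF, map_mul]
  ring

/-- The meromorphic function `f = F / G`. -/
def fMero : Mero F G := algebraMap (HolGerm n p) (Mero F G) F * invG F G

/-- The inverse `1 / f = G / F`. -/
def invf : Mero F G := algebraMap (HolGerm n p) (Mero F G) G * invF F G

theorem f_mul_invf : fMero F G * invf F G = 1 := by
  calc fMero F G * invf F G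
      = (algebraMap (HolGerm n p) (Mero F G) F * invF F G) *
        (algebraMap (HolGerm n p) (Mero F G) G * invG F G) := by
        rw [fMero, invf]; ring
    _ = 1 := by rw [F_mul_invF, G_mul_invG, one_mul]

/-- The partial derivative `∂_i` on `𝒪_p[1/(FG)]`. -/
def meroPartial (i : Fin n) : Derivation ℂ (Mero F G) (Mero F G) :=
  locDerivation (F * G) (germPartial n p i)

/-- The free module `𝓛 = 𝒪_p[1/(FG)][s] f^s` of rank one: the polynomial `a(s)` stands for the
element `a(s) f^s`. -/
def LMod : Type := (Mero F G)[X]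

instance : CommRing (LMod F G) := inferInstanceAs (CommRing (Mero F G)[X])

instance : Algebra ℂ (LMod F G) := inferInstanceAs (Algebra ℂ (Mero F G)[X])

/-- The element `a(s) f^s` of `𝓛` given by a polynomial `a(s)`. -/
def toL : (Mero F G)[X] ≃ₐ[ℂ] LMod F G := AlgEquiv.refl

/-- A derivation of the coefficient ring, applied to the coefficients of a polynomial in `s`. -/
def coeffDeriv {B : Type} [CommRing B] [Algebra ℂ B] (δ : Derivation ℂ B B) :
    B[X] →ₗ[ℂ] B[X] where
  toFun a := a.sum fun k c => Polynomial.monomial k (δ c)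
  map_add' a b := Polynomial.sum_add_index a b _ (by simp) (by simp)
  map_smul' c a := by
    ext k
    rw [Polynomial.sum_smul_index' _ _ _ (by simp)]
    simp only [Polynomial.sum_def, Polynomial.finsetSum_coeff, Polynomial.coeff_monomial,
      Polynomial.coeff_smul, Derivation.map_smul, RingHom.id_apply, Finset.smul_sum, smul_ite,
      smul_zero]

theorem coeff_coeffDeriv {B : Type} [CommRing B] [Algebra ℂ B] (δ : Derivation ℂ B B)
    (a : B[X]) (k : ℕ) : (coeffDeriv δ a).coeff k = δ (a.coeff k) := by
  simp only [coeffDeriv, LinearMap.coe_mk, AddHom.coe_mk, Polynomial.sum_def,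
    Polynomial.finsetSum_coeff, Polynomial.coeff_monomial, Finset.sum_ite_eq',
    Polynomial.mem_support_iff]
  split_ifs with h
  · rfl
  · rw [Polynomial.notMem_support_iff.1 h, map_zero]

/-- The action of `∂_i` on `𝓛`:
`∂_i (a(s) f^s) = (∂_i a(s) + s · a(s) · (∂_i f) / f) f^s`. -/
def opPartial (i : Fin n) : Module.End ℂ (LMod F G) :=
  (toL F G).toLinearMap ∘ₗ
    (coeffDeriv (meroPartial F G i) +
      LinearMap.mulLeft ℂ
        (Polynomial.X * Polynomial.C (meroPartial F G i (fMero F G) * invf F G))) ∘ₗ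
    (toL F G).symm.toLinearMap

/-- The action on `𝓛` of a meromorphic function `g`, by multiplication. -/
def opMul (g : Mero F G) : Module.End ℂ (LMod F G) :=
  LinearMap.mulLeft ℂ (toL F G (Polynomial.C g))

/-- The action of `s` on `𝓛`, by multiplication. -/
def opS : Module.End ℂ (LMod F G) :=
  LinearMap.mulLeft ℂ (toL F G Polynomial.X)

/-- The ring `𝒟̃ = 𝒟[1/G]` of differential operators at `p`, generated by the holomorphic germs,
by `1/G` and by `∂_1, …, ∂_n`, in its action on `𝓛`. (If `F` and `G` are nonzero, this action is
faithful, so that `𝒟̃` is identified with this ring of operators; this is also the case for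
`𝒟̃[s]` below, since an operator `P(s)` which annihilates `𝓛` annihilates, upon putting `s = k`,
all of `𝒪_p[1/(FG)]` for each integer `k`, hence satisfies `P(k) = 0` for each `k`.) -/
def DTilde : Subalgebra ℂ (Module.End ℂ (LMod F G)) :=
  Algebra.adjoin ℂ
    ((Set.range fun g : HolGerm n p => opMul F G (algebraMap (HolGerm n p) (Mero F G) g)) ∪
      {opMul F G (invG F G)} ∪ Set.range (opPartial F G))

instance : Ring (DTilde F G) := Subalgebra.toRing (DTilde F G)

/-- The ring `𝒟̃[s]`, generated by `𝒟̃` and `s`, in its action on `𝓛`. -/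
def DTildeS : Subalgebra ℂ (Module.End ℂ (LMod F G)) :=
  DTilde F G ⊔ Algebra.adjoin ℂ {opS F G}

/-- The element `(1/G^m) f^{s+k} = (f^k / G^m) f^s` of `𝓛`. -/
def sectionL (m k : ℕ) : LMod F G :=
  toL F G (Polynomial.C (fMero F G ^ k * invG F G ^ m))

/-- The functional equation `b(s) ((1/G^m) f^s) = P(s) ((1/G^m) f^{s+1})` for some operator
`P(s) ∈ 𝒟̃[s]`. -/
def ReducedFunctionalEq (m : ℕ) (b : ℂ[X]) : Prop :=
  ∃ P ∈ DTildeS F G,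
    Polynomial.aeval (opS F G) b (sectionL F G m 0) = P (sectionL F G m 1)

/-- `b` is the reduced Bernstein-Sato polynomial of `f = F / G` of order `m` at `p`: the nonzero
polynomial of least degree, normalised to be monic, which satisfies the functional equation. -/
def IsReducedBFunction (m : ℕ) (b : ℂ[X]) : Prop :=
  b.Monic ∧ ReducedFunctionalEq F G m b ∧
    ∀ c : ℂ[X], c ≠ 0 → ReducedFunctionalEq F G m c → b.natDegree ≤ c.natDegree

/-- The `𝒟̃`-submodule `𝒟̃ f^s` of `𝓛`. -/
def DTildeFs : Submodule (DTilde F G) (LMod F G) :=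
  Submodule.span (DTilde F G) {sectionL F G 0 0}

/-- The `𝒟̃`-submodule `∑_i 𝒟̃ f_i f^s` of `𝓛`, where `f_i = ∂_i f`; it lies in `𝒟̃ f^s`. -/
def jacobianSub : Submodule (DTilde F G) (LMod F G) :=
  Submodule.span (DTilde F G)
    (Set.range fun i : Fin n => opMul F G (meroPartial F G i (fMero F G)) (sectionL F G 0 0))

/-- The stalk at `p` of the module `𝓡̃ = 𝒟̃ f^s / ∑_i 𝒟̃ f_i f^s`. -/
abbrev RTilde : Type :=
  (DTildeFs F G) ⧸ (jacobianSub F G).submoduleOf (DTildeFs F G)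

end MeroBFun

end

/-!
Write `f = F / G` and `hᵢ = G ∂ᵢF - F ∂ᵢG`, so that `∂ᵢf = hᵢ / G²`. By Euler's formula,
`∑ wᵢ xᵢ hᵢ = (d₁ - d₂) F G`, so at a common zero of the `hᵢ` either `G` vanishes, or `F` and `df`
vanish, which smoothness excludes (`eq_zero_of_numerators_eq_zero`). Rückert's Nullstellensatz
(`mem_radical_of_vanishing`) then puts a power of `G` into the ideal of the `hᵢ`, that is,
`∑ cᵢ ∂ᵢf = 1` with `cᵢ ∈ 𝒪[1/G]`. Hence `f^s = ∑ cᵢ fᵢ f^s`, so `𝓡̃ = 0`, and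
`∑ cᵢ ∂ᵢ f^{s+1} = (s + 1) f^s`, which conjugated with `G ^ m` is the functional equation for
`s + 1`.

Conversely, operators in `𝒟̃[s]` specialize at `s = -1` to operators which preserve `𝒪[1/G]`, so a
functional equation for `b(s)` gives `b(-1) f⁻¹ ∈ 𝒪[1/G]`. If `b(-1) ≠ 0`, then `F` divides a power
of `G`, which is impossible because `𝒪` is factorial, `F` and `G` are coprime and `F(0) = 0`
(`eval_neg_one_eq_zero`). So `s + 1` divides every such `b(s)`.

Factoriality and the Nullstellensatz both rest on Weierstrass division (`weierstrass_division`).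
For its proof a function of `(y, z)` is regarded as an analytic family, parametrized by `y`, of
elements of the disc algebra of a small circle, where division by `f(y, ·)` is the inversion of a
linear operator which for `y = 0` is the identity. Factoriality follows by induction on the number
of variables from Gauss's lemma. For the Nullstellensatz, a prime ideal containing a Weierstrass
polynomial `W` is compared with its trace on the germs in one variable less: zeros of the trace
lift, since the resultant of `W` and a generic combination of other elements has coefficients in the
trace, and a function outside the ideal has a multiple which modulo the ideal is free of the last
variable (`IsWeierstrass.hasEnoughZeros`).
-/

noncomputable section

namespace MeroBFun

/-! ### Superposition operators on spaces of continuous maps -/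

section Superposition

variable {K V : Type*} [TopologicalSpace K] [CompactSpace K]
  [NormedAddCommGroup V] [NormedSpace ℂ V]

variable (K) in
/-- Pointwise application of a continuous multilinear form to continuous maps. -/
def superposeMultilinear {m : ℕ} (p : V [×m]→L[ℂ] ℂ) : C(K, V) [×m]→L[ℂ] C(K, ℂ) :=
  MultilinearMap.mkContinuous
    { toFun := fun φ => ⟨fun x => p fun i => φ i x, by fun_prop⟩
      map_update_add' := by
        intro _ φ i a b
        ext x
        have h (c : C(K, V)) : (fun j => Function.update φ i c j x) =
            Function.update (fun j => φ j x) i (c x) := by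
          ext j; by_cases hj : j = i
          · subst hj; simp
          · simp [hj]
        simp [h]
      map_update_smul' := by
        intro _ φ i c a
        ext x
        have h (c : C(K, V)) : (fun j => Function.update φ i c j x) =
            Function.update (fun j => φ j x) i (c x) := by
          ext j; by_cases hj : j = i
          · subst hj; simp
          · simp [hj]
        simp [h] } ‖p‖ (by
    intro φ
    refine (ContinuousMap.norm_le _ (by positivity)).2 fun x => ?_
    refine (p.le_opNorm _).trans ?_
    gcongr with i
    exact (φ i).norm_coe_le_norm x)

theorem norm_superposeMultilinear_le {m : ℕ} (p : V [×m]→L[ℂ] ℂ) :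
    ‖superposeMultilinear K p‖ ≤ ‖p‖ :=
  MultilinearMap.mkContinuous_norm_le _ (norm_nonneg _) _

/-- Composition with a function analytic at the origin is an analytic operation on small continuous
maps, with respect to the supremum norm. -/
theorem exists_analytic_superposition {f : V → ℂ} (hf : AnalyticAt ℂ f 0) :
    ∃ R : ℝ, 0 < R ∧ ∀ (K : Type) [TopologicalSpace K] [CompactSpace K],
      ∃ Φ : C(K, V) → C(K, ℂ), AnalyticOnNhd ℂ Φ (Metric.ball 0 R) ∧
        ∀ φ ∈ Metric.ball (0 : C(K, V)) R, ∀ x, Φ φ x = f (φ x) := by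
  obtain ⟨p, r, hp⟩ := hf
  obtain ⟨R, hR0, hRr⟩ := ENNReal.lt_iff_exists_nnreal_btwn.1 hp.r_pos
  have hRpos : 0 < R := by exact_mod_cast hR0
  refine ⟨R, by exact_mod_cast hRpos, fun K _ _ => ?_⟩
  let P : FormalMultilinearSeries ℂ C(K, V) C(K, ℂ) := fun m => superposeMultilinear K (p m)
  have hrad : r ≤ P.radius := hp.r_le.trans
    (FormalMultilinearSeries.radius_le_of_le fun m => norm_superposeMultilinear_le (p m))
  have hP := P.hasFPowerSeriesOnBall (lt_of_lt_of_le hp.r_pos hrad)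
  have hsub : Metric.ball (0 : C(K, V)) R ⊆ Metric.eball 0 P.radius := by
    rw [← Metric.eball_coe]
    exact Metric.eball_subset_eball (hRr.le.trans hrad)
  refine ⟨P.sum, hP.analyticOnNhd.mono hsub, fun φ hφ x => ?_⟩
  have h1 := hP.hasSum (hsub hφ)
  rw [zero_add] at h1
  have h2 := h1.mapL (ContinuousMap.evalCLM ℂ x)
  have hx : φ x ∈ Metric.eball (0 : V) r := by
    refine Metric.eball_subset_eball hRr.le ?_
    rw [Metric.eball_coe, mem_ball_zero_iff]
    exact (φ.norm_coe_le_norm x).trans_lt (mem_ball_zero_iff.1 hφ)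
  have h3 := hp.hasSum hx
  rw [zero_add] at h3
  exact h2.unique h3

end Superposition

/-! ### The disc algebra on a circle -/

section Circle

variable (ρ : ℝ)

/-- The Banach algebra of continuous functions on the circle of radius `ρ` about `0`. -/
abbrev CircleFun : Type := C(Metric.sphere (0 : ℂ) ρ, ℂ)

/-- The coordinate function on the circle. -/
def circleCoord : CircleFun ρ := ⟨fun x => x, continuous_subtype_val⟩

variable {ρ}

/-- The parametrization of the circle by angles. -/
def circleParam (hρ : 0 < ρ) : C(ℝ, Metric.sphere (0 : ℂ) ρ) :=
  ⟨fun θ => ⟨circleMap 0 ρ θ, circleMap_mem_sphere 0 hρ.le θ⟩, by fun_prop⟩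

/-- The functional `g ↦ (2πi)⁻¹ ∮ g(ζ) dζ`. -/
def circleMean (hρ : 0 < ρ) : CircleFun ρ →L[ℂ] ℂ :=
  LinearMap.mkContinuous
    { toFun := fun g => (2 * Real.pi * Complex.I)⁻¹ *
        ∫ θ in (0 : ℝ)..2 * Real.pi, (circleMap 0 ρ θ * Complex.I) * g (circleParam hρ θ)
      map_add' := by
        intro a b
        rw [← mul_add, ← intervalIntegral.integral_add]
        · simp [mul_add]
        · exact Continuous.intervalIntegrable (by fun_prop) _ _
        · exact Continuous.intervalIntegrable (by fun_prop) _ _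
      map_smul' := by
        intro c a
        simp only [ContinuousMap.coe_smul, Pi.smul_apply, smul_eq_mul, RingHom.id_apply]
        rw [mul_left_comm c, ← intervalIntegral.integral_const_mul c]
        simp only [mul_left_comm c] }
    ρ (by
      intro g
      have h := intervalIntegral.norm_integral_le_of_norm_le_const (a := 0) (b := 2 * Real.pi)
        (C := ρ * ‖g‖) (f := fun θ => (circleMap 0 ρ θ * Complex.I) * g (circleParam hρ θ)) (by
          intro θ _
          rw [norm_mul, norm_mul, Complex.norm_I, norm_circleMap_zero, abs_of_pos hρ, mul_one]
          gcongr
          exact g.norm_coe_le_norm _)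
      have hpi := Real.pi_pos
      simp only [LinearMap.coe_mk, AddHom.coe_mk, norm_mul, norm_inv, Complex.norm_I, mul_one,
        Complex.norm_real, Complex.norm_ofNat, Real.norm_eq_abs, abs_of_pos hpi]
      rw [sub_zero, abs_of_pos (by positivity)] at h
      rw [inv_mul_le_iff₀ (by positivity)]
      linarith)

theorem circleMean_eq_circleIntegral (hρ : 0 < ρ) (g : CircleFun ρ) (F : ℂ → ℂ)
    (h : ∀ x, g x = F x) :
    circleMean hρ g = (2 * Real.pi * Complex.I)⁻¹ • ∮ z in C(0, ρ), F z := by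
  simp only [circleMean, LinearMap.mkContinuous_apply, LinearMap.coe_mk, AddHom.coe_mk,
    circleIntegral, deriv_circleMap, smul_eq_mul, h]
  rfl

/-- The Cauchy kernel `ζ ↦ (ζ - z)⁻¹` on the circle, as an inverse in the Banach algebra; it has this
meaning for `z` in the open disc. -/
def cauchyKernel (ρ : ℝ) (z : ℂ) : CircleFun ρ :=
  Ring.inverse (circleCoord ρ - algebraMap ℂ _ z)

theorem isUnit_coord_sub {z : ℂ} (hz : z ∈ Metric.ball (0 : ℂ) ρ) :
    IsUnit (circleCoord ρ - algebraMap ℂ (CircleFun ρ) z) := by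
  rw [ContinuousMap.isUnit_iff_forall_ne_zero]
  intro x
  have hx : ‖(x : ℂ)‖ = ρ := by simp
  have hz' : ‖z‖ < ρ := by simpa using hz
  change (x : ℂ) - z ≠ 0
  rw [sub_ne_zero]
  intro h
  rw [h] at hx
  exact hz'.ne hx

theorem cauchyKernel_apply {z : ℂ} (hz : z ∈ Metric.ball (0 : ℂ) ρ) (x : Metric.sphere (0 : ℂ) ρ) :
    cauchyKernel ρ z x = ((x : ℂ) - z)⁻¹ := by
  have h := congrArg (fun φ : CircleFun ρ => φ x) (Ring.mul_inverse_cancel _ (isUnit_coord_sub hz))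
  change ((x : ℂ) - z) * cauchyKernel ρ z x = 1 at h
  exact eq_inv_of_mul_eq_one_right h

/-- The Cauchy integral of a function on the circle, at a point of the disc. -/
def cauchyEval (hρ : 0 < ρ) (z : ℂ) : CircleFun ρ →L[ℂ] ℂ :=
  circleMean hρ ∘L (ContinuousLinearMap.mul ℂ (CircleFun ρ)).flip (cauchyKernel ρ z)

theorem cauchyEval_apply (hρ : 0 < ρ) (z : ℂ) (q : CircleFun ρ) :
    cauchyEval hρ z q = circleMean hρ (q * cauchyKernel ρ z) := rfl

theorem cauchyEval_eq (hρ : 0 < ρ) {z : ℂ} (hz : z ∈ Metric.ball (0 : ℂ) ρ) {q : CircleFun ρ}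
    {F : ℂ → ℂ} (hF : DiffContOnCl ℂ F (Metric.ball 0 ρ)) (h : ∀ x, q x = F x) :
    cauchyEval hρ z q = F z := by
  rw [cauchyEval_apply, circleMean_eq_circleIntegral hρ _ fun x => (x - z)⁻¹ • F x]
  · exact hF.two_pi_i_inv_smul_circleIntegral_sub_inv_smul hz
  · intro x
    simp [cauchyKernel_apply hz, h, mul_comm]

/-- The Cauchy integral depends analytically on the function and on the point. -/
theorem analyticAt_cauchyEval (hρ : 0 < ρ) (q : CircleFun ρ) :
    AnalyticAt ℂ (fun x : CircleFun ρ × ℂ => cauchyEval hρ x.2 x.1) (q, 0) := by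
  have h0 : (0 : ℂ) ∈ Metric.ball (0 : ℂ) ρ := by simpa using hρ
  have hk : AnalyticAt ℂ (fun x : CircleFun ρ × ℂ => cauchyKernel ρ x.2) (q, 0) := by
    unfold cauchyKernel
    have h1 : AnalyticAt ℂ Ring.inverse (circleCoord ρ - algebraMap ℂ (CircleFun ρ) 0) :=
      analyticAt_inverse (isUnit_coord_sub h0).unit
    refine AnalyticAt.comp (g := Ring.inverse)
      (f := fun x : CircleFun ρ × ℂ => circleCoord ρ - algebraMap ℂ (CircleFun ρ) x.2) h1 ?_
    exact analyticAt_const.sub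
      (((Algebra.linearMap ℂ (CircleFun ρ)).toContinuousLinearMap.analyticAt _).comp
        analyticAt_snd)
  exact ((circleMean hρ).analyticAt _).comp (analyticAt_fst.mul hk)

/-- The disc algebra: the uniform closure of the polynomials on the circle. -/
def discAlgebra (ρ : ℝ) : Subalgebra ℂ (CircleFun ρ) :=
  (Algebra.adjoin ℂ {circleCoord ρ}).topologicalClosure

theorem isClosed_discAlgebra : IsClosed (discAlgebra ρ : Set (CircleFun ρ)) :=
  Subalgebra.isClosed_topologicalClosure _

theorem aeval_mem_discAlgebra (P : ℂ[X]) : Polynomial.aeval (circleCoord ρ) P ∈ discAlgebra ρ :=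
  Subalgebra.le_topologicalClosure _ (Polynomial.aeval_mem_adjoin_singleton ℂ _)

theorem aeval_circleCoord_apply (P : ℂ[X]) (x : Metric.sphere (0 : ℂ) ρ) :
    Polynomial.aeval (circleCoord ρ) P x = P.eval (x : ℂ) := by
  have h := Polynomial.aeval_algHom_apply (ContinuousMap.evalAlgHom ℂ ℂ x) (circleCoord ρ) P
  rw [Polynomial.coe_aeval_eq_eval] at h
  exact h.symm

/-- A closed condition on the disc algebra may be checked on polynomials. -/
theorem discAlgebra_induction {S : Set (CircleFun ρ)} (hS : IsClosed S)
    (h : ∀ P : ℂ[X], Polynomial.aeval (circleCoord ρ) P ∈ S) {q : CircleFun ρ}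
    (hq : q ∈ discAlgebra ρ) : q ∈ S := by
  refine closure_minimal ?_ hS hq
  intro a ha
  obtain ⟨P, rfl⟩ := (Algebra.adjoin_singleton_eq_range_aeval ℂ (circleCoord ρ)) ▸ ha
  exact h P

theorem cauchyEval_aeval (hρ : 0 < ρ) {z : ℂ} (hz : z ∈ Metric.ball (0 : ℂ) ρ) (P : ℂ[X]) :
    cauchyEval hρ z (Polynomial.aeval (circleCoord ρ) P) = P.eval z :=
  cauchyEval_eq hρ hz P.differentiable.diffContOnCl (aeval_circleCoord_apply P)

theorem cauchyEval_mul (hρ : 0 < ρ) {z : ℂ} (hz : z ∈ Metric.ball (0 : ℂ) ρ) {a b : CircleFun ρ}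
    (ha : a ∈ discAlgebra ρ) (hb : b ∈ discAlgebra ρ) :
    cauchyEval hρ z (a * b) = cauchyEval hρ z a * cauchyEval hρ z b := by
  refine discAlgebra_induction
    (S := {a | cauchyEval hρ z (a * b) = cauchyEval hρ z a * cauchyEval hρ z b})
    (isClosed_eq (by fun_prop) (by fun_prop)) (fun P => ?_) ha
  refine discAlgebra_induction
    (S := {b | cauchyEval hρ z (Polynomial.aeval (circleCoord ρ) P * b) =
      cauchyEval hρ z (Polynomial.aeval (circleCoord ρ) P) * cauchyEval hρ z b})
    (isClosed_eq (by fun_prop) (by fun_prop)) (fun Q => ?_) hb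
  rw [Set.mem_ofPred_eq, ← map_mul, cauchyEval_aeval hρ hz, cauchyEval_aeval hρ hz,
    cauchyEval_aeval hρ hz, Polynomial.eval_mul]

theorem mem_discAlgebra_of_differentiableOn (hρ : 0 < ρ) {R : ℝ} (hR : ρ < R) {F : ℂ → ℂ}
    (hF : DifferentiableOn ℂ F (Metric.ball 0 R)) {q : CircleFun ρ} (h : ∀ x, q x = F x) :
    q ∈ discAlgebra ρ := by
  obtain ⟨R', hρR', hR'⟩ := exists_between hR
  obtain ⟨R'', hρR'', hR''⟩ := exists_between hρR'
  lift R' to NNReal using (hρ.trans hρR').le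
  lift R'' to NNReal using (hρ.trans hρR'').le
  have hs := (hF.mono (Metric.closedBall_subset_ball hR')).hasFPowerSeriesOnBall
    (by exact_mod_cast hρ.trans hρR')
  have hu := hs.tendstoUniformlyOn (r' := R'') (by exact_mod_cast hR'')
  set p := cauchyPowerSeries F 0 R'
  let P (n : ℕ) : ℂ[X] := ∑ i ∈ Finset.range n, Polynomial.monomial i (p.coeff i)
  refine isClosed_discAlgebra.mem_of_tendsto (b := Filter.atTop)
    (f := fun n => Polynomial.aeval (circleCoord ρ) (P n)) ?_
    (Filter.Eventually.of_forall fun n => aeval_mem_discAlgebra _)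
  rw [ContinuousMap.tendsto_iff_tendstoUniformly]
  rw [Metric.tendstoUniformly_iff]
  rw [Metric.tendstoUniformlyOn_iff] at hu
  intro ε hε
  filter_upwards [hu ε hε] with n hn x
  have := hn x (by
    have hx : ‖(x : ℂ)‖ = ρ := by simp
    rw [mem_ball_zero_iff, hx]
    exact hρR'')
  rw [zero_add, ← h] at this
  convert this using 2
  rw [aeval_circleCoord_apply, Polynomial.eval_finsetSum]
  simp [FormalMultilinearSeries.partialSum, mul_comm]

/-- The backward shift `h ↦ (h - h(0)) / ζ`, where `h(0)` is given by the Cauchy integral. -/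
def backShift (hρ : 0 < ρ) : CircleFun ρ →L[ℂ] CircleFun ρ :=
  ContinuousLinearMap.mul ℂ (CircleFun ρ) (cauchyKernel ρ 0) ∘L
    (ContinuousLinearMap.id ℂ _ - (cauchyEval hρ 0).smulRight 1)

theorem coord_mul_backShift (hρ : 0 < ρ) (h : CircleFun ρ) :
    circleCoord ρ * backShift hρ h = h - algebraMap ℂ _ (cauchyEval hρ 0 h) := by
  have h0 : (0 : ℂ) ∈ Metric.ball (0 : ℂ) ρ := by simpa using hρ
  have h1 : circleCoord ρ * cauchyKernel ρ 0 = 1 := by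
    have := Ring.mul_inverse_cancel _ (isUnit_coord_sub h0)
    rw [cauchyKernel]
    simpa using this
  change circleCoord ρ * (cauchyKernel ρ 0 * (h - cauchyEval hρ 0 h • (1 : CircleFun ρ))) = _
  rw [← mul_assoc, h1, one_mul, Algebra.algebraMap_eq_smul_one]

theorem sum_backShift (hρ : 0 < ρ) (k : ℕ) (h : CircleFun ρ) :
    ∑ j ∈ Finset.range k, cauchyEval hρ 0 ((backShift hρ ^ j) h) • circleCoord ρ ^ j +
      circleCoord ρ ^ k * (backShift hρ ^ k) h = h := by
  induction k with
  | zero => simp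
  | succ k ih =>
    rw [Finset.sum_range_succ, pow_succ' (backShift hρ), mul_apply_eq_comp,
      pow_succ (circleCoord ρ), mul_assoc, coord_mul_backShift, mul_sub, Algebra.smul_def, ← ih]
    conv_rhs => rw [← ih]
    rw [ih]
    ring

theorem backShift_mem (hρ : 0 < ρ) {h : CircleFun ρ} (hh : h ∈ discAlgebra ρ) :
    backShift hρ h ∈ discAlgebra ρ := by
  have h0 : (0 : ℂ) ∈ Metric.ball (0 : ℂ) ρ := by simpa using hρ
  refine discAlgebra_induction (S := backShift hρ ⁻¹' discAlgebra ρ)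
    (isClosed_discAlgebra.preimage (by fun_prop)) (fun P => ?_) hh
  have h1 : circleCoord ρ * backShift hρ (Polynomial.aeval (circleCoord ρ) P) =
      circleCoord ρ * Polynomial.aeval (circleCoord ρ) P.divX := by
    rw [coord_mul_backShift, cauchyEval_aeval hρ h0]
    conv_lhs => rw [← Polynomial.X_mul_divX_add P]
    simp [Polynomial.coeff_zero_eq_eval_zero]
  have hu : IsUnit (circleCoord ρ) := by simpa using isUnit_coord_sub h0
  rw [Set.mem_preimage, hu.mul_left_cancel h1]
  exact aeval_mem_discAlgebra _

end Circle

/-! ### Weierstrass division -/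

section Division

/-- An analytic family of operators with value `1` at the origin can be inverted near the origin;
the solutions depend analytically on the parameter and stay in each closed invariant subspace. -/
theorem exists_analytic_solution {C E : Type*} [NormedAddCommGroup C] [NormedSpace ℂ C]
    [CompleteSpace C] [NormedAddCommGroup E] [NormedSpace ℂ E] {X : Submodule ℂ C}
    (hX : IsClosed (X : Set C)) {T : E → C →L[ℂ] C} (hT : AnalyticAt ℂ T 0) (hT0 : T 0 = 1)
    {Γ : E → C} (hΓ : AnalyticAt ℂ Γ 0) :
    ∃ H : E → C, AnalyticAt ℂ H 0 ∧ ∀ᶠ y in 𝓝 0, T y (H y) = Γ y ∧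
      ((∀ c ∈ X, T y c ∈ X) → Γ y ∈ X → H y ∈ X) := by
  have hi : AnalyticAt ℂ (fun y => Ring.inverse (1 - (1 - T y))) 0 := by
    refine AnalyticAt.comp (g := fun A : C →L[ℂ] C => Ring.inverse (1 - A)) ?_
      (analyticAt_const.sub hT)
    rw [hT0, sub_self]
    exact analyticAt_inverse_one_sub ℂ (C →L[ℂ] C)
  refine ⟨fun y => Ring.inverse (1 - (1 - T y)) (Γ y),
    ((ContinuousLinearMap.apply ℂ C).flip.analyticAt_bilinear _).comp₂ hi hΓ, ?_⟩
  have h1 : ContinuousAt (fun y => ‖1 - T y‖) 0 :=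
    (continuousAt_const.sub hT.continuousAt).norm
  have h2 : ∀ᶠ y in 𝓝 (0 : E), ‖1 - T y‖ < 1 := h1.eventually_lt_const (by simp [hT0])
  filter_upwards [h2] with y hy
  set A := 1 - T y with hA
  have hTA : T y = 1 - A := by rw [hA, sub_sub_cancel]
  have hinv := NormedRing.inverse_one_sub A hy
  refine ⟨?_, fun hTX hc => ?_⟩
  · have h3 : (1 - A) * Ring.inverse (1 - A) = 1 := by
      rw [hinv]
      exact (Units.oneSub A hy).mul_inv
    rw [hTA]
    exact congrArg (fun B : C →L[ℂ] C => B (Γ y)) h3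
  · have h3 : HasSum (fun n => A ^ n) (Ring.inverse (1 - A)) := by
      rw [hinv]
      exact (summable_geometric_of_norm_lt_one (x := A) hy).hasSum
    have h4 := h3.mapL (ContinuousLinearMap.apply ℂ C (Γ y))
    refine hX.mem_of_tendsto h4 (Filter.Eventually.of_forall fun s => X.sum_mem fun n hn => ?_)
    change (A ^ n) (Γ y) ∈ X
    clear hn h4 h3
    induction n with
    | zero => exact hc
    | succ n ih =>
      rw [pow_succ', mul_apply_eq_comp]
      exact X.sub_mem ih (hTX _ ih)

variable {E : Type*} [NormedAddCommGroup E] [NormedSpace ℂ E]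

/-- A function analytic at the origin of `E × ℂ` is an analytic family of elements of the disc
algebra of each small circle, parametrized by `E`. -/
theorem exists_analytic_discAlgebra {f : E × ℂ → ℂ} (hf : AnalyticAt ℂ f 0) :
    ∃ R : ℝ, 0 < R ∧ ∀ (ρ : ℝ) (hρ : 0 < ρ), ρ < R → ∃ Ψ : E → CircleFun ρ, AnalyticAt ℂ Ψ 0 ∧
      ∀ᶠ y in 𝓝 0, Ψ y ∈ discAlgebra ρ ∧ (∀ x, Ψ y x = f (y, x)) ∧
        ∀ z ∈ Metric.ball (0 : ℂ) ρ, cauchyEval hρ z (Ψ y) = f (y, z) := by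
  obtain ⟨R₁, hR₁, hΦ⟩ := exists_analytic_superposition hf
  obtain ⟨R₂, hR₂, hfR⟩ := Metric.eventually_nhds_iff_ball.1 hf.eventually_analyticAt
  refine ⟨min R₁ R₂, lt_min hR₁ hR₂, fun ρ hρ hρR => ?_⟩
  obtain ⟨Φ, hΦa, hΦe⟩ := hΦ (Metric.sphere (0 : ℂ) ρ)
  let L : E →L[ℂ] C(Metric.sphere (0 : ℂ) ρ, E × ℂ) :=
    LinearMap.mkContinuous
      { toFun := fun y => ContinuousMap.const _ (y, 0)
        map_add' := by intro a b; ext x <;> simp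
        map_smul' := by intro a b; ext x <;> simp } 1 (by
      intro y
      refine (ContinuousMap.norm_le _ (by positivity)).2 fun x => ?_
      simp [Prod.norm_def])
  let ι : C(Metric.sphere (0 : ℂ) ρ, E × ℂ) := ⟨fun x => (0, x), by fun_prop⟩
  have hL : AnalyticAt ℂ (fun y => L y + ι) 0 := (L.analyticAt 0).add analyticAt_const
  have hv (y : E) (x : Metric.sphere (0 : ℂ) ρ) : (L y + ι) x = (y, (x : ℂ)) := by
    change ((y, 0) : E × ℂ) + (0, (x : ℂ)) = _
    simp
  have hsmall : ∀ᶠ y in 𝓝 (0 : E), L y + ι ∈ Metric.ball 0 R₁ := by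
    refine hL.continuousAt.eventually_mem (Metric.isOpen_ball.mem_nhds ?_)
    rw [mem_ball_zero_iff]
    refine ((ContinuousMap.norm_le _ hρ.le).2 fun x => ?_).trans_lt (lt_min_iff.1 hρR).1
    rw [hv]
    simp [Prod.norm_def, hρ.le]
  refine ⟨fun y => Φ (L y + ι), AnalyticAt.comp (hΦa _ hsmall.self_of_nhds) hL, ?_⟩
  filter_upwards [hsmall, Metric.ball_mem_nhds (0 : E) hR₂] with y hy hyR
  have he (x : Metric.sphere (0 : ℂ) ρ) : Φ (L y + ι) x = f (y, x) := by
    rw [hΦe _ hy, hv]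
  have hd : DifferentiableOn ℂ (fun z => f (y, z)) (Metric.ball 0 R₂) := by
    intro z hz
    have hyz : (y, z) ∈ Metric.ball (0 : E × ℂ) R₂ := by
      rw [mem_ball_zero_iff] at *
      exact max_lt hyR hz
    exact ((hfR _ hyz).differentiableAt.comp z
      (by fun_prop : DifferentiableAt ℂ (fun z : ℂ => (y, z)) z)).differentiableWithinAt
  refine ⟨mem_discAlgebra_of_differentiableOn hρ (lt_min_iff.1 hρR).2 hd he, he, fun z hz => ?_⟩
  exact cauchyEval_eq hρ hz
    (hd.diffContOnCl_ball (Metric.closedBall_subset_ball (lt_min_iff.1 hρR).2)) he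

/-- **Weierstrass division**: if `f(0, z) = z ^ k * u(z)` with `u(0) ≠ 0`, then every function `g`
analytic at the origin is congruent modulo `f` to a polynomial in `z` of degree less than `k`. -/
theorem weierstrass_division {f g : E × ℂ → ℂ} (hf : AnalyticAt ℂ f 0) (hg : AnalyticAt ℂ g 0)
    {k : ℕ} {u : ℂ → ℂ} (hu : AnalyticAt ℂ u 0) (hu0 : u 0 ≠ 0)
    (hfu : ∀ᶠ z in 𝓝 0, f (0, z) = z ^ k * u z) :
    ∃ (q : E × ℂ → ℂ) (r : ℕ → E → ℂ), AnalyticAt ℂ q 0 ∧ (∀ j, AnalyticAt ℂ (r j) 0) ∧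
      ∀ᶠ x in 𝓝 0, g x = q x * f x + ∑ j ∈ Finset.range k, r j x.1 * x.2 ^ j := by
  obtain ⟨R₁, hR₁, hfR⟩ := exists_analytic_discAlgebra hf
  obtain ⟨R₂, hR₂, hgR⟩ := exists_analytic_discAlgebra hg
  have hev : ∀ᶠ z in 𝓝 (0 : ℂ), f (0, z) = z ^ k * u z ∧ u z ≠ 0 ∧
      DifferentiableAt ℂ (fun z => (u z)⁻¹) z := by
    filter_upwards [hfu, hu.continuousAt.eventually_ne hu0, hu.eventually_analyticAt]
      with z h1 h2 h3
    exact ⟨h1, h2, h3.differentiableAt.inv h2⟩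
  obtain ⟨R₃, hR₃, huR⟩ := Metric.eventually_nhds_iff_ball.1 hev
  obtain ⟨ρ, hρ, hρR⟩ := exists_between (lt_min hR₁ (lt_min hR₂ hR₃))
  obtain ⟨hρ₁, hρ₂, hρ₃⟩ : ρ < R₁ ∧ ρ < R₂ ∧ ρ < R₃ := by simpa using hρR
  have h0 : (0 : ℂ) ∈ Metric.ball (0 : ℂ) ρ := by simpa using hρ
  obtain ⟨Ψ, hΨ, hΨe⟩ := hfR ρ hρ hρ₁
  obtain ⟨Γ, hΓ, hΓe⟩ := hgR ρ hρ hρ₂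
  have hmem (x : Metric.sphere (0 : ℂ) ρ) : (x : ℂ) ∈ Metric.ball (0 : ℂ) R₃ := by
    rw [mem_ball_zero_iff]
    simpa using hρ₃
  have hvd : DifferentiableOn ℂ (fun z => (u z)⁻¹) (Metric.ball 0 R₃) :=
    fun z hz => (huR z hz).2.2.differentiableWithinAt
  let v : CircleFun ρ := ⟨fun x => (u x)⁻¹, by
    rw [continuous_iff_continuousAt]
    intro x
    exact (huR x (hmem x)).2.2.continuousAt.comp (f := ((↑) : Metric.sphere (0 : ℂ) ρ → ℂ))
      continuous_subtype_val.continuousAt⟩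
  have hvX : v ∈ discAlgebra ρ :=
    mem_discAlgebra_of_differentiableOn hρ hρ₃ hvd fun x => rfl
  have hζX : circleCoord ρ ∈ discAlgebra ρ := by
    simpa using aeval_mem_discAlgebra (ρ := ρ) Polynomial.X
  have hσX (j : ℕ) {c : CircleFun ρ} (hc : c ∈ discAlgebra ρ) :
      (backShift hρ ^ j) c ∈ discAlgebra ρ := by
    induction j with
    | zero => simpa using hc
    | succ j ih =>
      rw [pow_succ', mul_apply_eq_comp]
      exact backShift_mem hρ ih
  have hv0 : Ψ 0 * v = circleCoord ρ ^ k := by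
    ext x
    change Ψ 0 x * (u x)⁻¹ = (x : ℂ) ^ k
    obtain ⟨h1, h2, -⟩ := huR x (hmem x)
    rw [hΨe.self_of_nhds.2.1, h1, mul_assoc, mul_inv_cancel₀ h2, mul_one]
  -- The family of operators deforms the identity `sum_backShift`, which is its value at `y = 0`.
  let T (y : E) : CircleFun ρ →L[ℂ] CircleFun ρ :=
    ∑ j ∈ Finset.range k, (cauchyEval hρ 0 ∘L backShift hρ ^ j).smulRight (circleCoord ρ ^ j) +
      ContinuousLinearMap.mul ℂ (CircleFun ρ) (Ψ y * v) ∘L backShift hρ ^ k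
  have hTapp (y : E) (h : CircleFun ρ) : T y h =
      ∑ j ∈ Finset.range k, cauchyEval hρ 0 ((backShift hρ ^ j) h) • circleCoord ρ ^ j +
        Ψ y * v * (backShift hρ ^ k) h := by
    simp [T]
  have hT0 : T 0 = 1 := by
    ext1 h
    rw [hTapp, hv0, sum_backShift]
    rfl
  have hTa : AnalyticAt ℂ T 0 := by
    refine analyticAt_const.add ?_
    have h1 : AnalyticAt ℂ (fun y => ContinuousLinearMap.mul ℂ (CircleFun ρ) (Ψ y * v)) 0 :=
      ((ContinuousLinearMap.mul ℂ (CircleFun ρ)).analyticAt _).comp (hΨ.mul analyticAt_const)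
    exact (((ContinuousLinearMap.compL ℂ (CircleFun ρ) (CircleFun ρ) (CircleFun ρ)).flip
      (backShift hρ ^ k)).analyticAt _).comp h1
  obtain ⟨H, hHa, hH⟩ := exists_analytic_solution (X := (discAlgebra ρ).toSubmodule)
    isClosed_discAlgebra hTa hT0 hΓ
  let q (x : E × ℂ) : ℂ := cauchyEval hρ x.2 (v * (backShift hρ ^ k) (H x.1))
  let r (j : ℕ) (y : E) : ℂ := cauchyEval hρ 0 ((backShift hρ ^ j) (H y))
  refine ⟨q, r, ?_, fun j => ?_, ?_⟩
  · have h1 : AnalyticAt ℂ (fun x : E × ℂ => H x.1) 0 :=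
      AnalyticAt.comp (g := H) (f := Prod.fst) hHa analyticAt_fst
    have h2 : AnalyticAt ℂ (fun x : E × ℂ => v * (backShift hρ ^ k) (H x.1)) 0 :=
      analyticAt_const.mul (((backShift hρ ^ k).analyticAt _).comp h1)
    have h3 : AnalyticAt ℂ (fun x : E × ℂ => (v * (backShift hρ ^ k) (H x.1), x.2)) 0 :=
      h2.prod analyticAt_snd
    have h4 := (analyticAt_cauchyEval hρ (v * (backShift hρ ^ k) (H 0))).comp_of_eq h3 rfl
    exact h4
  · exact ((cauchyEval hρ 0 ∘L backShift hρ ^ j).analyticAt _).comp hHa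
  · rw [show (0 : E × ℂ) = (0, 0) from rfl, nhds_prod_eq]
    filter_upwards [(hΨe.and (hΓe.and hH)).prod_mk (Metric.ball_mem_nhds (0 : ℂ) hρ)]
    rintro ⟨y, z⟩ ⟨⟨⟨hΨX, -, hΨz⟩, ⟨hΓX, -, hΓz⟩, hTH, hHX⟩, hz⟩
    have hz : z ∈ Metric.ball (0 : ℂ) ρ := hz
    have hTX (c : CircleFun ρ) (hc : c ∈ (discAlgebra ρ).toSubmodule) :
        T y c ∈ (discAlgebra ρ).toSubmodule := by
      rw [hTapp]
      refine add_mem (sum_mem fun j _ => Submodule.smul_mem _ _ ?_) ?_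
      · exact pow_mem hζX j
      · exact (discAlgebra ρ).mul_mem (mul_mem hΨX hvX) (hσX k hc)
    have hHX : H y ∈ discAlgebra ρ := hHX hTX hΓX
    have hpow (j : ℕ) : cauchyEval hρ z (circleCoord ρ ^ j) = z ^ j := by
      have := cauchyEval_aeval hρ hz (Polynomial.X ^ j)
      simpa using this
    have h1 := congrArg (cauchyEval hρ z) hTH
    rw [hTapp, map_add, map_sum, hΓz z hz, mul_assoc, 
      cauchyEval_mul hρ hz hΨX (mul_mem hvX (hσX k hHX)), hΨz z hz] at h1
    simp only [map_smul, hpow, smul_eq_mul] at h1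
    rw [← h1, add_comm, mul_comm]

end Division

/-! ### Rings of germs of analytic functions -/

section Germs

variable (E : Type*) [NormedAddCommGroup E] [NormedSpace ℂ E]
  {E' : Type*} [NormedAddCommGroup E'] [NormedSpace ℂ E']

/-- The ring of functions on `E` which are analytic at the origin. -/
def FunAt : Subring (E → ℂ) where
  carrier := {g | AnalyticAt ℂ g 0}
  mul_mem' := AnalyticAt.mul
  one_mem' := analyticAt_const
  add_mem' := AnalyticAt.add
  zero_mem' := analyticAt_const
  neg_mem' := AnalyticAt.neg

/-- The ring of germs at the origin of analytic functions on a normed space `E`; for `E = ℂⁿ` this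
is `HolGerm n 0`. -/
def OGerm : Subring (Filter.Germ (𝓝 (0 : E)) ℂ) where
  carrier := {φ | ∃ g : E → ℂ, AnalyticAt ℂ g 0 ∧ (g : Filter.Germ (𝓝 (0 : E)) ℂ) = φ}
  mul_mem' := by
    rintro _ _ ⟨g, hg, rfl⟩ ⟨h, hh, rfl⟩
    exact ⟨g * h, hg.mul hh, rfl⟩
  one_mem' := ⟨1, analyticAt_const, rfl⟩
  add_mem' := by
    rintro _ _ ⟨g, hg, rfl⟩ ⟨h, hh, rfl⟩
    exact ⟨g + h, hg.add hh, rfl⟩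
  zero_mem' := ⟨0, analyticAt_const, rfl⟩
  neg_mem' := by
    rintro _ ⟨g, hg, rfl⟩
    exact ⟨-g, hg.neg, rfl⟩

variable {E}

/-- The germ of a function which is analytic at the origin. -/
def toGerm : FunAt E →+* OGerm E where
  toFun g := ⟨(g.1 : Filter.Germ (𝓝 (0 : E)) ℂ), g.1, g.2, rfl⟩
  map_one' := rfl
  map_mul' _ _ := rfl
  map_zero' := rfl
  map_add' _ _ := rfl

theorem toGerm_surjective : Function.Surjective (toGerm (E := E)) := by
  rintro ⟨_, g, hg, rfl⟩
  exact ⟨⟨g, hg⟩, rfl⟩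

theorem toGerm_eq_iff {g h : FunAt E} : toGerm g = toGerm h ↔ ∀ᶠ x in 𝓝 0, g.1 x = h.1 x := by
  rw [Subtype.ext_iff]
  exact Filter.Germ.coe_eq

theorem toGerm_eq_zero_iff {g : FunAt E} : toGerm g = 0 ↔ ∀ᶠ x in 𝓝 0, g.1 x = 0 := by
  rw [← map_zero toGerm]
  exact toGerm_eq_iff

/-- Evaluation at a point, as a ring homomorphism on functions. -/
def evalAt (x : E) : FunAt E →+* ℂ := (Pi.evalRingHom _ x).comp (FunAt E).subtype

@[simp] theorem evalAt_apply (x : E) (g : FunAt E) : evalAt x g = g.1 x := rfl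

/-- The value of a germ at the origin. -/
def germValue : OGerm E →+* ℂ := (Filter.Germ.valueRingHom).comp (OGerm E).subtype

@[simp] theorem germValue_toGerm (g : FunAt E) : germValue (toGerm g) = g.1 0 := rfl

theorem isUnit_toGerm_iff {g : FunAt E} : IsUnit (toGerm g) ↔ g.1 0 ≠ 0 := by
  refine ⟨fun h => by simpa using h.map germValue, fun h => ?_⟩
  refine IsUnit.of_mul_eq_one (toGerm ⟨fun x => (g.1 x)⁻¹, g.2.inv h⟩) ?_
  rw [← map_mul, ← map_one toGerm, toGerm_eq_iff]
  filter_upwards [g.2.continuousAt.eventually_ne h] with x hx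
  exact mul_inv_cancel₀ hx

theorem isUnit_iff_germValue {φ : OGerm E} : IsUnit φ ↔ germValue φ ≠ 0 := by
  obtain ⟨g, rfl⟩ := toGerm_surjective φ
  exact isUnit_toGerm_iff

instance : IsDomain (OGerm E) := by
  have : Nontrivial (OGerm E) := ⟨0, 1, fun h => by simpa using congrArg germValue h⟩
  have : NoZeroDivisors (OGerm E) := by
    refine ⟨fun {a b} hab => ?_⟩
    obtain ⟨f, rfl⟩ := toGerm_surjective a
    obtain ⟨g, rfl⟩ := toGerm_surjective b
    rw [← map_mul, toGerm_eq_zero_iff] at hab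
    obtain ⟨R, hR, h⟩ := Metric.eventually_nhds_iff_ball.1
      (hab.and (f.2.eventually_analyticAt.and g.2.eventually_analyticAt))
    by_cases hf : ∀ x ∈ Metric.ball (0 : E) R, f.1 x = 0
    · left
      rw [toGerm_eq_zero_iff]
      filter_upwards [Metric.ball_mem_nhds (0 : E) hR] using hf
    · right
      push Not at hf
      obtain ⟨x, hx, hfx⟩ := hf
      rw [toGerm_eq_zero_iff]
      have hga : AnalyticOnNhd ℂ g.1 (Metric.ball 0 R) := fun y hy => (h y hy).2.2
      have hgx : g.1 =ᶠ[𝓝 x] 0 := by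
        filter_upwards [(h x hx).2.1.continuousAt.eventually_ne hfx,
          Metric.isOpen_ball.mem_nhds hx] with y hy hyR
        exact (mul_eq_zero.1 (h y hyR).1).resolve_left hy
      filter_upwards [Metric.ball_mem_nhds (0 : E) hR] with y hy
      exact hga.eqOn_zero_of_preconnected_of_eventuallyEq_zero
        (convex_ball (0 : E) R).isPreconnected hx hgx hy
  exact NoZeroDivisors.to_isDomain _

/-- The pullback of analytic functions along a continuous linear map. -/
def funPull (L : E →L[ℂ] E') : FunAt E' →+* FunAt E where
  toFun g := ⟨fun x => g.1 (L x), AnalyticAt.comp_of_eq g.2 (L.analyticAt 0) (map_zero L)⟩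
  map_one' := rfl
  map_mul' _ _ := rfl
  map_zero' := rfl
  map_add' _ _ := rfl

theorem funPull_apply (L : E →L[ℂ] E') (g : FunAt E') (x : E) : (funPull L g).1 x = g.1 (L x) := rfl

/-- The pullback of germs along a continuous linear map. -/
def germPull (L : E →L[ℂ] E') : OGerm E' →+* OGerm E where
  toFun φ := ⟨φ.1.compTendsto L (by simpa using (L.continuous.tendsto 0)), by
    obtain ⟨g, rfl⟩ := toGerm_surjective φ
    exact (toGerm (funPull L g)).2⟩
  map_one' := rfl
  map_mul' a b := by
    obtain ⟨f, rfl⟩ := toGerm_surjective a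
    obtain ⟨g, rfl⟩ := toGerm_surjective b
    rfl
  map_zero' := rfl
  map_add' a b := by
    obtain ⟨f, rfl⟩ := toGerm_surjective a
    obtain ⟨g, rfl⟩ := toGerm_surjective b
    rfl

theorem germPull_toGerm (L : E →L[ℂ] E') (g : FunAt E') :
    germPull L (toGerm g) = toGerm (funPull L g) := rfl

/-- A linear isomorphism induces an isomorphism of rings of germs. -/
def germEquiv (L : E ≃L[ℂ] E') : OGerm E' ≃+* OGerm E :=
  RingEquiv.ofRingHom (germPull (L : E →L[ℂ] E')) (germPull (L.symm : E' →L[ℂ] E))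
    (by
      ext1 φ
      obtain ⟨g, rfl⟩ := toGerm_surjective φ
      change toGerm (funPull _ (funPull _ g)) = toGerm g
      congr 1
      ext x
      simp [funPull_apply])
    (by
      ext1 φ
      obtain ⟨g, rfl⟩ := toGerm_surjective φ
      change toGerm (funPull _ (funPull _ g)) = toGerm g
      congr 1
      ext x
      simp [funPull_apply])

theorem germEquiv_toGerm (L : E ≃L[ℂ] E') (g : FunAt E') :
    germEquiv L (toGerm g) = toGerm (funPull (L : E →L[ℂ] E') g) := rfl

/-- Germs on `E` as germs on `E × ℂ` which do not depend on the last variable. -/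
instance : Algebra (OGerm E) (OGerm (E × ℂ)) :=
  (germPull (ContinuousLinearMap.fst ℂ E ℂ)).toAlgebra

theorem algebraMap_toGerm (g : FunAt E) :
    algebraMap (OGerm E) (OGerm (E × ℂ)) (toGerm g) =
      toGerm (funPull (ContinuousLinearMap.fst ℂ E ℂ) g) := rfl

variable (E) in
/-- The last coordinate on `E × ℂ`. -/
def lastFun : FunAt (E × ℂ) := ⟨Prod.snd, analyticAt_snd⟩

variable (E) in
/-- The germ of the last coordinate on `E × ℂ`. -/
def lastCoord : OGerm (E × ℂ) := toGerm (lastFun E)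

/-- The function `(y, z) ↦ P(y, z)` defined by a polynomial in `z` with analytic coefficients. -/
def polyFun (P : (FunAt E)[X]) : FunAt (E × ℂ) :=
  P.eval₂ (funPull (ContinuousLinearMap.fst ℂ E ℂ)) (lastFun E)

theorem polyFun_apply (P : (FunAt E)[X]) (x : E × ℂ) :
    (polyFun P).1 x = (P.map (evalAt x.1)).eval x.2 := by
  change evalAt x (polyFun P) = _
  rw [polyFun, Polynomial.hom_eval₂, Polynomial.eval_map]
  rfl

theorem aeval_lastCoord (P : (FunAt E)[X]) :
    Polynomial.aeval (lastCoord E) (P.map toGerm) = toGerm (polyFun P) := by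
  rw [polyFun, Polynomial.hom_eval₂, Polynomial.aeval_def, Polynomial.eval₂_map]
  rfl

theorem exists_monic_lift {P : (OGerm E)[X]} (hP : P.Monic) :
    ∃ Q : (FunAt E)[X], Q.map toGerm = P ∧ Q.natDegree = P.natDegree ∧ Q.Monic :=
  Polynomial.lifts_and_natDegree_eq_and_monic
    ((Polynomial.lifts_iff_coeff_lifts _).2 fun _ => toGerm_surjective _) hP

end Germs

/-! ### Regular germs -/

section Regular

variable {E : Type*} [NormedAddCommGroup E] [NormedSpace ℂ E]

/-- A germ on `E × ℂ` is regular if it does not vanish identically on the last coordinate axis. -/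
def IsRegularGerm (φ : OGerm (E × ℂ)) : Prop :=
  germPull (ContinuousLinearMap.inr ℂ E ℂ) φ ≠ 0

/-- A nonzero germ does not vanish identically on some line through the origin. -/
theorem exists_line_ne_zero [Nontrivial E] {φ : OGerm E} (hφ : φ ≠ 0) :
    ∃ v : E, v ≠ 0 ∧ germPull (ContinuousLinearMap.toSpanSingleton ℂ v) φ ≠ 0 := by
  obtain ⟨f, rfl⟩ := toGerm_surjective φ
  rw [Ne, toGerm_eq_zero_iff] at hφ
  obtain ⟨R, hR, h⟩ := Metric.eventually_nhds_iff_ball.1 f.2.eventually_analyticAt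
  have hex : ∃ v ∈ Metric.ball (0 : E) R, v ≠ 0 ∧ f.1 v ≠ 0 := by
    by_contra hcon
    push Not at hcon
    have h0 : ∀ x ∈ Metric.ball (0 : E) R, x ≠ 0 → f.1 x = 0 := hcon
    apply hφ
    have h1 : ∀ᶠ x in 𝓝[≠] (0 : E), f.1 x = 0 := by
      filter_upwards [nhdsWithin_le_nhds (Metric.ball_mem_nhds (0 : E) hR), self_mem_nhdsWithin]
        with x hx hx0 using h0 x hx hx0
    have : (𝓝[≠] (0 : E)).NeBot := Module.punctured_nhds_neBot ℂ E 0
    have h2 : f.1 0 = 0 := by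
      have ht := f.2.continuousAt.tendsto.mono_left (nhdsWithin_le_nhds (s := {(0 : E)}ᶜ))
      exact tendsto_nhds_unique ht (tendsto_const_nhds.congr' (h1.mono fun x hx => hx.symm))
    filter_upwards [Metric.ball_mem_nhds (0 : E) hR] with x hx
    by_cases hx0 : x = 0
    · rw [hx0, h2]
    · exact h0 x hx hx0
  obtain ⟨v, hvR, hv0, hfv⟩ := hex
  refine ⟨v, hv0, fun hz => hfv ?_⟩
  rw [germPull_toGerm, toGerm_eq_zero_iff] at hz
  let L := ContinuousLinearMap.toSpanSingleton ℂ v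
  have ha : AnalyticOnNhd ℂ (fun t : ℂ => f.1 (L t)) (L ⁻¹' Metric.ball 0 R) :=
    fun t ht => AnalyticAt.comp (h _ ht) (L.analyticAt t)
  have hc : IsPreconnected (L ⁻¹' Metric.ball 0 R) :=
    ((convex_ball (0 : E) R).is_linear_preimage
      (f := (L.restrictScalars ℝ)) (L.restrictScalars ℝ).toLinearMap.isLinear).isPreconnected
  have h1 := ha.eqOn_zero_of_preconnected_of_eventuallyEq_zero hc (z₀ := 0) (by simpa using hR) hz
    (show (1 : ℂ) ∈ _ by simpa [L] using hvR)
  simpa [L] using h1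

/-- After a linear change of coordinates, a nonzero germ becomes regular. -/
theorem exists_equiv_isRegularGerm {φ : OGerm (E × ℂ)} (hφ : φ ≠ 0) :
    ∃ L : (E × ℂ) ≃L[ℂ] (E × ℂ), IsRegularGerm (germEquiv L φ) := by
  obtain ⟨v, hv, h⟩ := exists_line_ne_zero hφ
  obtain ⟨L, hL⟩ := SeparatingDual.exists_continuousLinearEquiv_apply_eq (R := ℂ)
    (x := ((0, 1) : E × ℂ)) (y := v) (by simp) hv
  refine ⟨L, fun h0 => h ?_⟩
  obtain ⟨f, rfl⟩ := toGerm_surjective φ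
  rw [germEquiv_toGerm, germPull_toGerm, toGerm_eq_zero_iff] at h0
  rw [germPull_toGerm, toGerm_eq_zero_iff]
  filter_upwards [h0] with z hz
  rw [← hz]
  simp only [funPull_apply]
  have hz1 : L (ContinuousLinearMap.inr ℂ E ℂ z) = z • v := by
    rw [← hL, ← map_smul]
    simp
  exact congrArg f.1 hz1.symm

end Regular

/-! ### Weierstrass polynomials and Weierstrass preparation -/

section WeierstrassPolynomials

/-- A polynomial which is a continuous multiple of `∏ (z - a)` near all the points `a` vanishes if
its degree is less than their number. -/
theorem eq_zero_of_eval_eq_mul_prod {D : Set ℂ} (hD : IsOpen D) {q : ℂ → ℂ}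
    (hq : ContinuousOn q D) (s : Multiset ℂ) (hs : ∀ a ∈ s, a ∈ D) (r : ℂ[X])
    (h : ∀ z ∈ D, r.eval z = q z * (s.map fun a => z - a).prod) (hdeg : r.degree < s.card) :
    r = 0 := by
  induction s using Multiset.induction_on generalizing r with
  | empty => simpa using hdeg
  | cons a s ih =>
    have ha : a ∈ D := hs a (Multiset.mem_cons_self a s)
    have hr : r.eval a = 0 := by rw [h a ha]; simp
    obtain ⟨t, rfl⟩ := Polynomial.dvd_iff_isRoot.2 hr
    have ht : t = 0 := by
      refine ih (fun b hb => hs b (Multiset.mem_cons_of_mem hb)) t (fun z hz => ?_) ?_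
      · have hne : ∀ z ∈ D, z ≠ a → t.eval z - q z * (s.map fun b => z - b).prod = 0 := by
          intro z hz hza
          have h1 := h z hz
          simp only [Polynomial.eval_mul, Polynomial.eval_sub, Polynomial.eval_X,
            Polynomial.eval_C, Multiset.map_cons, Multiset.prod_cons] at h1
          have h2 : (z - a) * (t.eval z - q z * (s.map fun b => z - b).prod) = 0 := by
            linear_combination h1
          exact (mul_eq_zero.1 h2).resolve_left (sub_ne_zero.2 hza)
        by_cases hza : z = a
        · subst hza
          have hc : ContinuousAt (fun w => t.eval w - q w * (s.map fun b => w - b).prod) z := by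
            refine t.continuous.continuousAt.sub
              ((hq.continuousAt (hD.mem_nhds hz)).mul (Continuous.continuousAt ?_))
            exact continuous_multiset_prod _ fun b _ => continuous_id.sub continuous_const
          have h1 : ∀ᶠ w in 𝓝[≠] z, t.eval w - q w * (s.map fun b => w - b).prod = 0 := by
            filter_upwards [nhdsWithin_le_nhds (hD.mem_nhds hz), self_mem_nhdsWithin]
              with w hw hwz using hne w hw hwz
          have h2 := tendsto_nhds_unique (hc.tendsto.mono_left nhdsWithin_le_nhds)
            (tendsto_const_nhds.congr' (h1.mono fun w hw => hw.symm))
          exact sub_eq_zero.1 h2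
        · exact sub_eq_zero.1 (hne z hz hza)
      · by_cases ht0 : t = 0
        · simp [ht0]
        · rw [Polynomial.degree_mul, Polynomial.degree_X_sub_C, Polynomial.degree_eq_natDegree ht0,
            Multiset.card_cons] at hdeg
          rw [Polynomial.degree_eq_natDegree ht0]
          have hdeg' : ((1 + t.natDegree : ℕ) : WithBot ℕ) < ((s.card + 1 : ℕ) : WithBot ℕ) := by
            exact_mod_cast hdeg
          rw [Nat.cast_lt] at hdeg' ⊢
          omega
    rw [ht, mul_zero]

variable {E : Type*} [NormedAddCommGroup E] [NormedSpace ℂ E]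

/-- The roots of a monic polynomial with analytic coefficients which specializes to a power of the
variable at the origin tend to zero. -/
theorem eventually_roots_small {W : (FunAt E)[X]} (hW : W.Monic)
    (hW0 : W.map (evalAt 0) = Polynomial.X ^ W.natDegree) {ε : ℝ} (hε : 0 < ε) :
    ∀ᶠ y in 𝓝 (0 : E), ∀ z : ℂ, (W.map (evalAt y)).eval z = 0 → ‖z‖ < ε := by
  set k := W.natDegree with hk
  have hcoef (j : ℕ) (hj : j < k) : (W.coeff j).1 0 = 0 := by
    have := congrArg (fun P => Polynomial.coeff P j) hW0
    simpa [Polynomial.coeff_X_pow, hj.ne] using this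
  have hS : ∀ᶠ y in 𝓝 (0 : E), ∑ j ∈ Finset.range k, ‖(W.coeff j).1 y‖ / ε ^ (k - j) < 1 := by
    have hc : ContinuousAt
        (fun y : E => ∑ j ∈ Finset.range k, ‖(W.coeff j).1 y‖ / ε ^ (k - j)) 0 := by
      refine tendsto_finsetSum _ fun j _ => ?_
      exact ((W.coeff j).2.continuousAt.norm).div_const _
    refine hc.eventually_lt_const ?_
    have h0 : ∑ j ∈ Finset.range k, ‖(W.coeff j).1 0‖ / ε ^ (k - j) = 0 :=
      Finset.sum_eq_zero fun j hj => by simp [hcoef j (Finset.mem_range.1 hj)]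
    exact h0.trans_lt one_pos
  filter_upwards [hS] with y hy z hz
  by_contra hzε
  push Not at hzε
  have hz0 : 0 < ‖z‖ := hε.trans_le hzε
  rw [hW.as_sum] at hz
  simp only [Polynomial.map_add, Polynomial.map_pow, Polynomial.map_X, Polynomial.map_sum,
    Polynomial.map_mul, Polynomial.map_C, Polynomial.eval_add, Polynomial.eval_pow,
    Polynomial.eval_X, Polynomial.eval_finsetSum, Polynomial.eval_mul, Polynomial.eval_C,
    evalAt_apply, ← hk] at hz
  have h1 : ‖z‖ ^ k ≤ ‖z‖ ^ k * ∑ j ∈ Finset.range k, ‖(W.coeff j).1 y‖ / ε ^ (k - j) := by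
    rw [Finset.mul_sum]
    conv_lhs => rw [← norm_pow, eq_neg_of_add_eq_zero_left hz, norm_neg]
    refine (norm_sum_le _ _).trans (Finset.sum_le_sum fun j hj => ?_)
    have hjk := Finset.mem_range.1 hj
    rw [norm_mul, norm_pow, mul_div_assoc', le_div_iff₀ (by positivity)]
    calc ‖(W.coeff j).1 y‖ * ‖z‖ ^ j * ε ^ (k - j)
        ≤ ‖(W.coeff j).1 y‖ * ‖z‖ ^ j * ‖z‖ ^ (k - j) := by gcongr
      _ = ‖z‖ ^ k * ‖(W.coeff j).1 y‖ := by
          rw [mul_assoc, ← pow_add, Nat.add_sub_cancel' hjk.le, mul_comm]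
  have h2 : ‖z‖ ^ k * ∑ j ∈ Finset.range k, ‖(W.coeff j).1 y‖ / ε ^ (k - j) < ‖z‖ ^ k * 1 := by
    gcongr
  linarith

/-- A Weierstrass polynomial: a monic polynomial whose lower coefficients vanish at the origin. -/
def IsWeierstrass (W : (OGerm E)[X]) : Prop :=
  W.Monic ∧ W.map germValue = Polynomial.X ^ W.natDegree

theorem germValue_aeval (P : (OGerm E)[X]) :
    germValue (Polynomial.aeval (lastCoord E) P) = (P.map germValue).eval 0 := by
  rw [Polynomial.aeval_def, Polynomial.hom_eval₂, Polynomial.eval_map]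
  congr 1
  ext φ
  obtain ⟨g, rfl⟩ := toGerm_surjective φ
  rfl

theorem IsWeierstrass.exists_lift {W : (OGerm E)[X]} (hW : IsWeierstrass W) :
    ∃ V : (FunAt E)[X], V.map toGerm = W ∧ V.natDegree = W.natDegree ∧ V.Monic ∧
      V.map (evalAt 0) = Polynomial.X ^ V.natDegree := by
  obtain ⟨V, h1, h2, h3⟩ := exists_monic_lift hW.1
  refine ⟨V, h1, h2, h3, ?_⟩
  rw [h2, ← hW.2, ← h1, Polynomial.map_map]
  rfl

/-- Uniqueness in Weierstrass division: a polynomial of degree less than that of a Weierstrass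
polynomial `W` is not a multiple of `W` in the ring of germs, unless it is zero. For each small
value of the parameters, all roots of `W` are small, so this follows by counting roots. -/
theorem IsWeierstrass.eq_zero_of_dvd {W : (OGerm E)[X]} (hW : IsWeierstrass W) {P : (OGerm E)[X]}
    (hP : P.degree < W.degree)
    (h : Polynomial.aeval (lastCoord E) W ∣ Polynomial.aeval (lastCoord E) P) : P = 0 := by
  obtain ⟨V, hVW, hVdeg, hVm, hV0⟩ := hW.exists_lift
  obtain ⟨Q, hQP, hQdeg⟩ := Polynomial.exists_degree_eq_of_mem_lifts (f := toGerm (E := E)) (p := P)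
    ((Polynomial.lifts_iff_coeff_lifts _).2 fun _ => toGerm_surjective _)
  obtain ⟨c, hc⟩ := h
  obtain ⟨q, rfl⟩ := toGerm_surjective c
  rw [← hVW, ← hQP, aeval_lastCoord, aeval_lastCoord, ← map_mul, toGerm_eq_iff,
    show (0 : E × ℂ) = (0, 0) from rfl] at hc
  have hev := hc.and q.2.eventually_analyticAt
  rw [nhds_prod_eq] at hev
  obtain ⟨p₁, hp₁, p₂, hp₂, hall⟩ := Filter.eventually_prod_iff.1 hev
  obtain ⟨ε, hε, hball⟩ := Metric.eventually_nhds_iff_ball.1 hp₂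
  have hzero : ∀ᶠ y in 𝓝 (0 : E), Q.map (evalAt y) = 0 := by
    filter_upwards [hp₁, eventually_roots_small hVm hV0 hε] with y hy hroots
    have hVy : (V.map (evalAt y)).Monic := hVm.map _
    have hsplit := IsAlgClosed.splits (V.map (evalAt y))
    have hcard : (V.map (evalAt y)).roots.card = V.natDegree := by
      rw [← hsplit.natDegree_eq_card_roots, hVm.natDegree_map]
    refine eq_zero_of_eval_eq_mul_prod (D := Metric.ball 0 ε) Metric.isOpen_ball
      (q := fun z => q.1 (y, z)) ?_ (V.map (evalAt y)).roots ?_ _ ?_ ?_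
    · intro z hz
      have h1 : ContinuousAt q.1 (y, z) := (hall hy (hball z hz)).2.continuousAt
      exact (ContinuousAt.comp (f := fun z : ℂ => (y, z)) h1 (by fun_prop)).continuousWithinAt
    · intro a ha
      rw [mem_ball_zero_iff]
      exact hroots a (Polynomial.isRoot_of_mem_roots ha)
    · intro z hz
      have h1 := (hall hy (hball z hz)).1
      have h2 : (polyFun V * q).1 (y, z) = (polyFun V).1 (y, z) * q.1 (y, z) := rfl
      rw [h2, polyFun_apply, polyFun_apply] at h1
      rw [h1, mul_comm]
      congr 1
      conv_lhs => rw [hsplit.eq_prod_roots_of_monic hVy]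
      rw [Polynomial.eval_multiset_prod, Multiset.map_map]
      simp
    · rw [hcard, hVdeg, ← Polynomial.degree_eq_natDegree hW.1.ne_zero]
      exact (Polynomial.degree_map_le).trans_lt (hQdeg.trans_lt hP)
  rw [← hQP]
  ext1 j
  rw [Polynomial.coeff_map, Polynomial.coeff_zero, toGerm_eq_zero_iff]
  filter_upwards [hzero] with y hy
  simpa using congrArg (fun R => Polynomial.coeff R j) hy

theorem IsWeierstrass.dvd_of_aeval_dvd {W : (OGerm E)[X]} (hW : IsWeierstrass W) {P : (OGerm E)[X]}
    (h : Polynomial.aeval (lastCoord E) W ∣ Polynomial.aeval (lastCoord E) P) : W ∣ P := by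
  rw [← Polynomial.modByMonic_eq_zero_iff_dvd hW.1]
  refine hW.eq_zero_of_dvd (Polynomial.degree_modByMonic_lt _ hW.1) ?_
  rw [Polynomial.modByMonic_eq_sub_mul_div, map_sub, map_mul]
  exact dvd_sub h (dvd_mul_right _ _)

/-- Division of germs, by a function of order `k` on the last coordinate axis. -/
theorem exists_div_of_order (f : FunAt (E × ℂ)) (φ : OGerm (E × ℂ)) {k : ℕ} {u : ℂ → ℂ}
    (hu : AnalyticAt ℂ u 0) (hu0 : u 0 ≠ 0) (hfu : ∀ᶠ z in 𝓝 0, f.1 (0, z) = z ^ k * u z) :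
    ∃ (q : OGerm (E × ℂ)) (r : (OGerm E)[X]), r.degree < k ∧
      φ = q * toGerm f + Polynomial.aeval (lastCoord E) r := by
  obtain ⟨g, rfl⟩ := toGerm_surjective φ
  obtain ⟨q, r, hq, hr, h⟩ := weierstrass_division f.2 g.2 hu hu0 hfu
  let Q : (FunAt E)[X] := ∑ j ∈ Finset.range k, Polynomial.monomial j ⟨r j, hr j⟩
  refine ⟨toGerm ⟨q, hq⟩, Q.map toGerm, ?_, ?_⟩
  · refine Polynomial.degree_map_le.trans_lt ?_
    refine Polynomial.mem_degreeLT.1 (sum_mem fun j hj => Polynomial.mem_degreeLT.2 ?_)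
    exact (Polynomial.degree_monomial_le _ _).trans_lt (by exact_mod_cast Finset.mem_range.1 hj)
  · rw [aeval_lastCoord, ← map_mul, ← map_add, toGerm_eq_iff]
    filter_upwards [h] with x hx
    rw [hx]
    change _ = q x * f.1 x + (polyFun Q).1 x
    rw [polyFun_apply]
    simp [Q, Polynomial.map_sum, Polynomial.eval_finsetSum]

/-- Weierstrass division by a Weierstrass polynomial. -/
theorem IsWeierstrass.exists_div {W : (OGerm E)[X]} (hW : IsWeierstrass W) (φ : OGerm (E × ℂ)) :
    ∃ (q : OGerm (E × ℂ)) (r : (OGerm E)[X]), r.degree < W.degree ∧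
      φ = q * Polynomial.aeval (lastCoord E) W + Polynomial.aeval (lastCoord E) r := by
  obtain ⟨V, hVW, hVdeg, hVm, hV0⟩ := hW.exists_lift
  have h := exists_div_of_order (polyFun V) φ (k := W.natDegree) (u := fun _ => 1)
    analyticAt_const one_ne_zero (Filter.Eventually.of_forall fun z => by
      rw [polyFun_apply, hV0, hVdeg]
      simp)
  rwa [← aeval_lastCoord, hVW, ← Polynomial.degree_eq_natDegree hW.1.ne_zero] at h

/-- **Weierstrass preparation**: a regular germ is associated with a Weierstrass polynomial. -/
theorem IsRegularGerm.exists_weierstrass {φ : OGerm (E × ℂ)} (hφ : IsRegularGerm φ) :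
    ∃ W : (OGerm E)[X], IsWeierstrass W ∧ Associated (Polynomial.aeval (lastCoord E) W) φ := by
  obtain ⟨f, rfl⟩ := toGerm_surjective φ
  have hreg : ¬ ∀ᶠ z in 𝓝 (0 : ℂ), f.1 (0, z) = 0 := by
    rwa [IsRegularGerm, germPull_toGerm, Ne, toGerm_eq_zero_iff] at hφ
  have hfa : AnalyticAt ℂ (fun z : ℂ => f.1 (0, z)) 0 :=
    (funPull (ContinuousLinearMap.inr ℂ E ℂ) f).2
  obtain ⟨k, u, hu, hu0, hfu⟩ := hfa.exists_eventuallyEq_pow_smul_nonzero_iff.2 hreg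
  simp only [sub_zero, smul_eq_mul] at hfu
  obtain ⟨q, r, hr, h⟩ := exists_div_of_order f (lastCoord E ^ k) hu hu0 hfu
  obtain ⟨c, rfl⟩ := toGerm_surjective q
  obtain ⟨R, rfl, -⟩ := Polynomial.exists_degree_eq_of_mem_lifts (f := toGerm (E := E)) (p := r)
    ((Polynomial.lifts_iff_coeff_lifts _).2 fun _ => toGerm_surjective _)
  have h' := h
  rw [aeval_lastCoord, lastCoord, ← map_pow, ← map_mul, ← map_add, toGerm_eq_iff] at h'
  have hline : ∀ᶠ z in 𝓝 (0 : ℂ), z ^ k = c.1 (0, z) * (z ^ k * u z) +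
      (R.map (evalAt 0)).eval z := by
    have ht : Filter.Tendsto (fun z : ℂ => ((0 : E), z)) (𝓝 0) (𝓝 0) := by
      have : Continuous (fun z : ℂ => ((0 : E), z)) := by fun_prop
      exact this.tendsto' 0 0 rfl
    filter_upwards [ht.eventually h', hfu] with z h1 h2
    have h3 : z ^ k = c.1 (0, z) * f.1 (0, z) + (polyFun R).1 (0, z) := h1
    rwa [h2, polyFun_apply] at h3
  have hca : AnalyticAt ℂ (fun z : ℂ => c.1 (0, z)) 0 :=
    (funPull (ContinuousLinearMap.inr ℂ E ℂ) c).2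
  have hmap : (R.map (toGerm (E := E))).map germValue = R.map (evalAt 0) := by
    rw [Polynomial.map_map]; rfl
  have hR0 : R.map (evalAt 0) = 0 := by
    obtain ⟨ε, hε, hball⟩ := Metric.eventually_nhds_iff_ball.1
      (hline.and (hca.eventually_analyticAt.and hu.eventually_analyticAt))
    refine eq_zero_of_eval_eq_mul_prod (D := Metric.ball 0 ε) Metric.isOpen_ball
      (q := fun z => 1 - c.1 (0, z) * u z) ?_ (Multiset.replicate k 0) ?_ _ ?_ ?_
    · intro z hz
      obtain ⟨-, h1, h2⟩ := hball z hz
      exact (continuousAt_const.sub (h1.continuousAt.mul h2.continuousAt)).continuousWithinAt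
    · intro a ha
      rw [Multiset.eq_of_mem_replicate ha]
      simpa using hε
    · intro z hz
      have h1 := (hball z hz).1
      simp only [Multiset.map_replicate, sub_zero, Multiset.prod_replicate]
      linear_combination -h1
    · rw [Multiset.card_replicate, ← hmap]
      exact Polynomial.degree_map_le.trans_lt hr
  have hc0 : c.1 0 ≠ 0 := by
    have h1 : ∀ᶠ z in 𝓝[≠] (0 : ℂ), c.1 (0, z) * u z = 1 := by
      filter_upwards [nhdsWithin_le_nhds hline, self_mem_nhdsWithin] with z h1 h2
      rw [hR0, Polynomial.eval_zero, add_zero] at h1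
      have h3 : z ^ k ≠ 0 := pow_ne_zero _ h2
      apply mul_left_cancel₀ h3
      linear_combination -h1
    have h2 := tendsto_nhds_unique
      ((hca.continuousAt.mul hu.continuousAt).tendsto.mono_left nhdsWithin_le_nhds)
      (tendsto_const_nhds.congr' (h1.mono fun w hw => hw.symm))
    exact left_ne_zero_of_mul_eq_one h2
  have hdeg : (Polynomial.X ^ k - R.map (toGerm (E := E))).natDegree = k := by
    apply Polynomial.natDegree_eq_of_degree_eq_some
    rw [Polynomial.degree_sub_eq_left_of_degree_lt] <;> rw [Polynomial.degree_X_pow]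
    exact hr
  refine ⟨Polynomial.X ^ k - R.map toGerm, ⟨Polynomial.monic_X_pow_sub hr, ?_⟩, ?_⟩
  · rw [hdeg, Polynomial.map_sub, hmap, hR0]
    simp
  · rw [map_sub, map_pow, Polynomial.aeval_X, h, add_sub_cancel_right]
    exact associated_unit_mul_left _ _ (isUnit_toGerm_iff.2 hc0)

end WeierstrassPolynomials

/-! ### Germ rings are Noetherian and factorial: adding one variable -/

section Induction

variable {E : Type*} [NormedAddCommGroup E] [NormedSpace ℂ E]

/-- Every nonzero germ is, after a linear change of coordinates, associated with a Weierstrass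
polynomial. -/
theorem exists_equiv_weierstrass {φ : OGerm (E × ℂ)} (hφ : φ ≠ 0) :
    ∃ (L : (E × ℂ) ≃L[ℂ] (E × ℂ)) (W : (OGerm E)[X]), IsWeierstrass W ∧
      Associated (Polynomial.aeval (lastCoord E) W) (germEquiv L φ) := by
  obtain ⟨L, hL⟩ := exists_equiv_isRegularGerm hφ
  obtain ⟨W, hW, h⟩ := hL.exists_weierstrass
  exact ⟨L, W, hW, h⟩

/-- Modulo a Weierstrass polynomial, every germ is a polynomial in the last coordinate. -/
theorem IsWeierstrass.quotient_surjective {W : (OGerm E)[X]} (hW : IsWeierstrass W)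
    {I : Ideal (OGerm (E × ℂ))} (hI : Polynomial.aeval (lastCoord E) W ∈ I) :
    Function.Surjective ((Ideal.Quotient.mk I).comp
      (Polynomial.aeval (R := OGerm E) (lastCoord E)).toRingHom) := by
  intro x
  obtain ⟨φ, rfl⟩ := Ideal.Quotient.mk_surjective x
  obtain ⟨q, r, -, h⟩ := hW.exists_div φ
  refine ⟨r, ?_⟩
  rw [h, map_add, Ideal.Quotient.eq_zero_iff_mem.2 (I.mul_mem_left q hI), zero_add]
  rfl

theorem isNoetherianRing_prod [IsNoetherianRing (OGerm E)] : IsNoetherianRing (OGerm (E × ℂ)) := by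
  refine ⟨fun I => ?_⟩
  by_cases hI : I = ⊥
  · rw [hI]
    exact Submodule.fg_bot
  obtain ⟨φ, hφI, hφ⟩ := Submodule.exists_mem_ne_zero_of_ne_bot hI
  obtain ⟨L, W, hW, hassoc⟩ := exists_equiv_weierstrass hφ
  set w := Polynomial.aeval (lastCoord E) W
  let J : Ideal (OGerm (E × ℂ)) := Ideal.map (germEquiv L).toRingHom I
  have hwJ : w ∈ J :=
    (Ideal.mem_iff_of_associated hassoc).2 (Ideal.mem_map_of_mem _ hφI)
  have hnoeth : IsNoetherianRing (OGerm (E × ℂ) ⧸ Ideal.span {w}) :=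
    isNoetherianRing_of_surjective _ _ _
      (hW.quotient_surjective (Ideal.mem_span_singleton_self w))
  have hJ : J.FG := by
    refine Ideal.fg_of_fg_map_of_fg_inf_ker_of_surjective (hnoeth.noetherian _) ?_
      (Ideal.Quotient.mk_surjective (I := Ideal.span {w}))
    have h1 : J ⊓ RingHom.ker (Ideal.Quotient.mk (Ideal.span {w})) = Ideal.span {w} := by
      rw [Ideal.mk_ker, inf_eq_right, Ideal.span_le]
      simpa using hwJ
    rw [h1]
    exact ⟨{w}, by simp⟩
  have hIJ : I = Ideal.map (germEquiv L).symm.toRingHom J := by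
    rw [Ideal.map_map, RingEquiv.symm_toRingHom_comp_toRingHom, Ideal.map_id]
  rw [hIJ]
  exact hJ.map _

/-- A Weierstrass polynomial is irreducible as soon as its germ is. -/
theorem IsWeierstrass.irreducible {W : (OGerm E)[X]} (hW : IsWeierstrass W)
    (hirr : Irreducible (Polynomial.aeval (lastCoord E) W)) : Irreducible W := by
  have key (f : (OGerm E)[X]) (hf : f.Monic) (hfW : f ∣ W)
      (hu : IsUnit (Polynomial.aeval (lastCoord E) f)) : f.natDegree = 0 := by
    rw [isUnit_iff_germValue, germValue_aeval] at hu
    have hdvd : f.map germValue ∣ Polynomial.X ^ W.natDegree := by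
      rw [← hW.2]
      exact Polynomial.map_dvd germValue hfW
    obtain ⟨i, -, hi⟩ := (dvd_prime_pow Polynomial.prime_X _).1 hdvd
    have hi0 : i = 0 := by
      by_contra hne
      apply hu
      have : Polynomial.X ∣ f.map germValue := (dvd_pow_self _ hne).trans hi.symm.dvd
      exact Polynomial.eval_eq_zero_of_dvd_of_eval_eq_zero this Polynomial.eval_X
    rw [hi0, pow_zero, associated_one_iff_isUnit] at hi
    rw [← hf.natDegree_map germValue]
    exact Polynomial.natDegree_eq_zero_of_isUnit hi
  refine hW.1.irreducible_iff_natDegree.2 ⟨?_, fun f g hf hg hfg => ?_⟩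
  · rintro rfl
    exact hirr.not_isUnit (by simp)
  · rw [← hfg, map_mul] at hirr
    rcases hirr.isUnit_or_isUnit rfl with h | h
    · exact Or.inl (key f hf (hfg ▸ dvd_mul_right f g) h)
    · exact Or.inr (key g hg (hfg ▸ dvd_mul_left g f) h)

theorem IsWeierstrass.prime [UniqueFactorizationMonoid (OGerm E)] {W : (OGerm E)[X]}
    (hW : IsWeierstrass W) (hirr : Irreducible (Polynomial.aeval (lastCoord E) W)) :
    Prime (Polynomial.aeval (lastCoord E) W) := by
  have hWp : Prime W := (hW.irreducible hirr).prime
  refine ⟨hirr.ne_zero, hirr.not_isUnit, fun x y hxy => ?_⟩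
  obtain ⟨q, r, -, rfl⟩ := hW.exists_div x
  obtain ⟨q', r', -, rfl⟩ := hW.exists_div y
  set w := Polynomial.aeval (lastCoord E) W with hw
  have h1 : w ∣ Polynomial.aeval (lastCoord E) (r * r') := by
    rw [map_mul]
    have h2 : (q * w + Polynomial.aeval (lastCoord E) r) *
        (q' * w + Polynomial.aeval (lastCoord E) r') =
        w * (q * (q' * w + Polynomial.aeval (lastCoord E) r') +
          q' * Polynomial.aeval (lastCoord E) r) +
        Polynomial.aeval (lastCoord E) r * Polynomial.aeval (lastCoord E) r' := by ring
    rw [h2] at hxy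
    exact (dvd_add_right (dvd_mul_right _ _)).1 hxy
  rcases hWp.dvd_or_dvd (hW.dvd_of_aeval_dvd h1) with h | h
  · exact Or.inl (dvd_add (dvd_mul_left _ _) (map_dvd (Polynomial.aeval (lastCoord E)) h))
  · exact Or.inr (dvd_add (dvd_mul_left _ _) (map_dvd (Polynomial.aeval (lastCoord E)) h))

theorem uniqueFactorizationMonoid_prod [IsNoetherianRing (OGerm E)]
    [UniqueFactorizationMonoid (OGerm E)] : UniqueFactorizationMonoid (OGerm (E × ℂ)) := by
  have := isNoetherianRing_prod (E := E)
  have hwf : WfDvdMonoid (OGerm (E × ℂ)) := inferInstance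
  refine { irreducible_iff_prime := fun {φ} => ⟨fun h => ?_, Prime.irreducible⟩ }
  obtain ⟨L, W, hW, hassoc⟩ := exists_equiv_weierstrass h.ne_zero
  have h1 : Irreducible (germEquiv L φ) := (MulEquiv.irreducible_iff (germEquiv L)).2 h
  have h2 := hW.prime (hassoc.irreducible_iff.2 h1)
  exact (MulEquiv.prime_iff (germEquiv L)).1 (hassoc.prime_iff.1 h2)

end Induction

/-! ### Germ rings in finitely many variables -/

section Finite

/-- A linear isomorphism between `ℂⁿ × ℂ` and `ℂⁿ⁺¹`; any choice will do. -/
def prodEquivFin (n : ℕ) : ((Fin n → ℂ) × ℂ) ≃L[ℂ] (Fin (n + 1) → ℂ) :=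
  ContinuousLinearEquiv.ofFinrankEq (by simp)

theorem isField_oGerm_of_subsingleton {E : Type*} [NormedAddCommGroup E] [NormedSpace ℂ E]
    [Subsingleton E] : IsField (OGerm E) := by
  refine ⟨⟨0, 1, zero_ne_one⟩, mul_comm, fun {φ} hφ => ?_⟩
  obtain ⟨f, rfl⟩ := toGerm_surjective φ
  have h0 : f.1 0 ≠ 0 := by
    intro h
    refine hφ (toGerm_eq_zero_iff.2 (Filter.Eventually.of_forall fun x => ?_))
    rwa [Subsingleton.elim x 0]
  obtain ⟨b, hb⟩ := (isUnit_toGerm_iff.2 h0).exists_right_inv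
  exact ⟨b, hb⟩

/-- The ring of germs of holomorphic functions in `n` variables is a Noetherian factorial ring. -/
theorem isNoetherianRing_and_uniqueFactorizationMonoid_oGerm (n : ℕ) :
    IsNoetherianRing (OGerm (Fin n → ℂ)) ∧ UniqueFactorizationMonoid (OGerm (Fin n → ℂ)) := by
  induction n with
  | zero =>
    let := (isField_oGerm_of_subsingleton (E := Fin 0 → ℂ)).toField
    exact ⟨inferInstance, inferInstance⟩
  | succ n ih =>
    obtain ⟨h1, h2⟩ := ih
    have h3 := isNoetherianRing_prod (E := Fin n → ℂ)
    have h4 := uniqueFactorizationMonoid_prod (E := Fin n → ℂ)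
    exact ⟨isNoetherianRing_of_ringEquiv _ (germEquiv (prodEquivFin n)).symm,
      (germEquiv (prodEquivFin n)).symm.toMulEquiv.uniqueFactorizationMonoid h4⟩

end Finite

/-! ### Rückert's Nullstellensatz -/

section Nullstellensatz

variable {E : Type*} [NormedAddCommGroup E] [NormedSpace ℂ E]
  {E' : Type*} [NormedAddCommGroup E'] [NormedSpace ℂ E']

/-- An ideal `P` of germs has enough zeros if for finitely many functions with germs in `P` and any
function `g` with germ outside `P` there are, arbitrarily close to the origin, common zeros of the
former at which `g` does not vanish. -/
def HasEnoughZeros (P : Ideal (OGerm E)) : Prop :=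
  ∀ (m : ℕ) (h : Fin m → FunAt E), (∀ i, toGerm (h i) ∈ P) → ∀ g : FunAt E, toGerm g ∉ P →
    ∃ᶠ x in 𝓝 (0 : E), (∀ i, (h i).1 x = 0) ∧ g.1 x ≠ 0

theorem hasEnoughZeros_bot : HasEnoughZeros (⊥ : Ideal (OGerm E)) := by
  intro m h hh g hg
  rw [Ideal.mem_bot, toGerm_eq_zero_iff] at hg
  have h1 : ∀ᶠ x in 𝓝 (0 : E), ∀ i, (h i).1 x = 0 :=
    Filter.eventually_all.2 fun i => toGerm_eq_zero_iff.1 (Ideal.mem_bot.1 (hh i))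
  exact h1.and_frequently (Filter.not_eventually.1 hg)

theorem HasEnoughZeros.of_equiv (L : E ≃L[ℂ] E') {P : Ideal (OGerm E')}
    (hP : HasEnoughZeros (P.comap (germEquiv L).symm.toRingHom)) : HasEnoughZeros P := by
  have key (f : FunAt E') : toGerm (funPull (L : E →L[ℂ] E') f) ∈
      P.comap (germEquiv L).symm.toRingHom ↔ toGerm f ∈ P := by
    rw [← germEquiv_toGerm, Ideal.mem_comap]
    change (germEquiv L).symm (germEquiv L (toGerm f)) ∈ P ↔ _
    rw [RingEquiv.symm_apply_apply]
  intro m h hh g hg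
  have h1 := hP m (fun i => funPull (L : E →L[ℂ] E') (h i)) (fun i => (key _).2 (hh i))
    (funPull (L : E →L[ℂ] E') g) (fun hc => hg ((key _).1 hc))
  have ht : Filter.Tendsto L (𝓝 0) (𝓝 0) := by simpa using L.continuous.tendsto 0
  exact ht.frequently h1

/-- Finitely many polynomials `r i` have a common root among the roots of a monic polynomial `V`
if `V` has a root in common with each combination `∑ i, t ^ i * r i`. -/
theorem exists_common_root {m : ℕ} (V : ℂ[X]) (r : Fin m → ℂ[X])
    (h : ∀ t : ℂ, ∃ z ∈ V.roots, ∑ i : Fin m, t ^ (i : ℕ) * (r i).eval z = 0) :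
    ∃ z ∈ V.roots, ∀ i, (r i).eval z = 0 := by
  choose z hz h0 using h
  obtain ⟨⟨z₀, hz₀⟩, hinf⟩ := Finite.exists_infinite_fiber
    (fun t : ℂ => (⟨z t, Multiset.mem_toFinset.2 (hz t)⟩ : V.roots.toFinset))
  refine ⟨z₀, Multiset.mem_toFinset.1 hz₀, ?_⟩
  let Q : ℂ[X] := ∑ i : Fin m, Polynomial.monomial (i : ℕ) ((r i).eval z₀)
  have hQ : Q = 0 := by
    refine Polynomial.eq_zero_of_infinite_isRoot Q ((Set.infinite_coe_iff.1 hinf).mono ?_)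
    intro t ht
    have ht' : z t = z₀ := congrArg Subtype.val (show _ = _ from ht)
    have := h0 t
    rw [ht'] at this
    simpa [Q, Polynomial.eval_finsetSum, mul_comm] using this
  intro i
  have := congrArg (fun R => Polynomial.coeff R (i : ℕ)) hQ
  simpa [Q, Polynomial.finsetSum_coeff, Polynomial.coeff_monomial, Fin.val_inj] using this

/-- The resultant `Res(V, ∑ tⁱ rᵢ)` as a polynomial in `t`: its coefficients lie in every ideal
containing `V` and all `rᵢ`, and where they vanish, `V` and all `rᵢ` have a common root. -/
theorem exists_elimination {m : ℕ} {V : (FunAt E)[X]} (hV : V.Monic) (hV0 : V.natDegree ≠ 0)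
    (r : Fin m → (FunAt E)[X]) (hr : ∀ i, (r i).natDegree ≤ V.natDegree) :
    ∃ R : (FunAt E)[X],
      (∀ P : Ideal (OGerm (E × ℂ)), toGerm (polyFun V) ∈ P → (∀ i, toGerm (polyFun (r i)) ∈ P) →
        ∀ j, algebraMap _ (OGerm (E × ℂ)) (toGerm (R.coeff j)) ∈ P) ∧
      ∀ y : E, (∀ j, (R.coeff j).1 y = 0) →
        ∃ z ∈ (V.map (evalAt y)).roots, ∀ i, ((r i).map (evalAt y)).eval z = 0 := by
  set k := V.natDegree with hk
  let V' : (FunAt E)[X][X] := V.map Polynomial.C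
  let p : (FunAt E)[X][X] := 
    ∑ i : Fin m, Polynomial.C (Polynomial.X ^ (i : ℕ)) * (r i).map Polynomial.C
  have hV'deg : V'.natDegree ≤ k := Polynomial.natDegree_map_le
  have hpdeg : p.natDegree ≤ k := by
    refine Polynomial.natDegree_sum_le_of_forall_le _ _ fun i _ => ?_
    exact (Polynomial.natDegree_C_mul_le _ _).trans (Polynomial.natDegree_map_le.trans (hr i))
  refine ⟨V'.resultant p k k, fun P hVP hrP j => ?_, fun y hy => ?_⟩
  · obtain ⟨a, b, -, -, hab⟩ := Polynomial.exists_mul_add_mul_eq_C_resultant V' p hV'deg hpdeg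
      (Or.inl hV0)
    let Ψ : FunAt E →+* OGerm (E × ℂ) ⧸ P :=
      (Ideal.Quotient.mk P).comp ((algebraMap (OGerm E) (OGerm (E × ℂ))).comp toGerm)
    let z : OGerm (E × ℂ) ⧸ P := Ideal.Quotient.mk P (lastCoord E)
    have hΨ (Q : (FunAt E)[X]) : Q.eval₂ Ψ z = Ideal.Quotient.mk P (toGerm (polyFun Q)) := by
      rw [← aeval_lastCoord, Polynomial.aeval_def, Polynomial.hom_eval₂, Polynomial.eval₂_map]
      rfl
    let Φ : (FunAt E)[X][X] →+* (OGerm (E × ℂ) ⧸ P)[X] :=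
      Polynomial.eval₂RingHom (Polynomial.mapRingHom Ψ) (Polynomial.C z)
    have hΦ (Q : (FunAt E)[X]) : Φ (Q.map Polynomial.C) =
        Polynomial.C (Ideal.Quotient.mk P (toGerm (polyFun Q))) := by
      rw [← hΨ, Polynomial.hom_eval₂]
      simp only [Φ, Polynomial.coe_eval₂RingHom, Polynomial.eval₂_map]
      congr 1
      ext1 c
      simp
    have hres : Φ (Polynomial.C (V'.resultant p k k)) = 0 := by
      have hp0 : Φ p = 0 := by
        rw [map_sum]
        refine Finset.sum_eq_zero fun i _ => ?_
        rw [map_mul, hΦ, Ideal.Quotient.eq_zero_iff_mem.2 (hrP i), map_zero, mul_zero]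
      rw [← hab, map_add, map_mul, map_mul, hp0, hΦ, Ideal.Quotient.eq_zero_iff_mem.2 hVP,
        map_zero, zero_mul, zero_mul, add_zero]
    have h1 : (V'.resultant p k k).map Ψ = 0 := by
      simpa [Φ] using hres
    have h2 := congrArg (fun Q => Polynomial.coeff Q j) h1
    rw [Polynomial.coeff_map, Polynomial.coeff_zero] at h2
    exact Ideal.Quotient.eq_zero_iff_mem.1 h2
  · have hVy : (V.map (evalAt y)).Monic := hV.map _
    have hVydeg : (V.map (evalAt y)).natDegree = k := hV.natDegree_map _
    refine exists_common_root _ _ fun t => ?_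
    let χ : (FunAt E)[X] →+* ℂ := Polynomial.eval₂RingHom (evalAt y) t
    have hχC : χ.comp Polynomial.C = evalAt y := by ext1 c; simp [χ]
    have hRy : χ (V'.resultant p k k) = 0 := by
      have h1 : (V'.resultant p k k).map (evalAt y) = 0 := by
        ext1 j
        rw [Polynomial.coeff_map, Polynomial.coeff_zero]
        exact hy j
      change Polynomial.eval₂ (evalAt y) t (V'.resultant p k k) = 0
      rw [← Polynomial.eval_map, h1, Polynomial.eval_zero]
    have hV'y : V'.map χ = V.map (evalAt y) := by rw [Polynomial.map_map, hχC]
    have hpdeg' : (p.map χ).natDegree ≤ k := Polynomial.natDegree_map_le.trans hpdeg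
    have h2 := Polynomial.resultant_eq_prod_eval (V.map (evalAt y)) (p.map χ) k hpdeg'
      (IsAlgClosed.splits _)
    rw [hVydeg, ← hV'y, Polynomial.resultant_map_map, hRy, hV'y, hVy.leadingCoeff, one_pow,
      one_mul] at h2
    obtain ⟨z, hz, hz0⟩ := Multiset.mem_map.1 (Multiset.prod_eq_zero_iff.1 h2.symm)
    refine ⟨z, hz, ?_⟩
    rw [← hz0]
    simp only [p, Polynomial.map_sum, Polynomial.map_mul, Polynomial.map_C, Polynomial.map_map,
      hχC, Polynomial.eval_finsetSum, Polynomial.eval_mul, Polynomial.eval_C]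
    refine Finset.sum_congr rfl fun i _ => ?_
    simp [χ]

/-- Every germ outside a prime ideal which contains a Weierstrass polynomial has, modulo that ideal,
a multiple which does not depend on the last coordinate and lies outside the ideal. -/
theorem IsWeierstrass.exists_multiple_notMem {W : (OGerm E)[X]} (hW : IsWeierstrass W)
    {P : Ideal (OGerm (E × ℂ))} [P.IsPrime] (hWP : Polynomial.aeval (lastCoord E) W ∈ P)
    {g : OGerm (E × ℂ)} (hg : g ∉ P) :
    ∃ (a : OGerm E) (b c : OGerm (E × ℂ)), algebraMap _ (OGerm (E × ℂ)) a ∉ P ∧ c ∈ P ∧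
      algebraMap _ (OGerm (E × ℂ)) a = c + b * g := by
  let ι : OGerm E →+* OGerm (E × ℂ) ⧸ P := (Ideal.Quotient.mk P).comp (algebraMap _ _)
  obtain ⟨r, hr⟩ := hW.quotient_surjective hWP (Ideal.Quotient.mk P g)
  have hint : ι.IsIntegralElem (Ideal.Quotient.mk P g) := by
    have hz : IsIntegral (OGerm E) (Ideal.Quotient.mk P (lastCoord E)) := by
      refine ⟨W, hW.1, ?_⟩
      have h1 := Polynomial.hom_eval₂ W (algebraMap (OGerm E) (OGerm (E × ℂ)))
        (Ideal.Quotient.mk P) (lastCoord E)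
      exact h1.symm.trans (Ideal.Quotient.eq_zero_iff_mem.2 hWP)
    have h2 : Ideal.Quotient.mk P g =
        Polynomial.aeval (Ideal.Quotient.mk P (lastCoord E)) r := by
      rw [← hr]
      exact Polynomial.hom_eval₂ r (algebraMap (OGerm E) (OGerm (E × ℂ)))
        (Ideal.Quotient.mk P) (lastCoord E)
    have h3 : Polynomial.aeval (Ideal.Quotient.mk P (lastCoord E)) r ∈
        integralClosure (OGerm E) (OGerm (E × ℂ) ⧸ P) :=
      (Algebra.adjoin_le (Set.singleton_subset_iff.2 hz))
        (Polynomial.aeval_mem_adjoin_singleton _ _)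
    rw [h2]
    exact h3
  obtain ⟨p, hp, hp0⟩ := hint
  have hpP : p.eval₂ (algebraMap (OGerm E) (OGerm (E × ℂ))) g ∈ P := by
    rw [← Ideal.Quotient.eq_zero_iff_mem, Polynomial.hom_eval₂]
    exact hp0
  have hcomap : (P.comap (algebraMap (OGerm E) (OGerm (E × ℂ)))) ≠ ⊤ :=
    Ideal.comap_ne_top _ (Ideal.IsPrime.ne_top')
  have : Nontrivial (OGerm E ⧸ P.comap (algebraMap (OGerm E) (OGerm (E × ℂ)))) :=
    Ideal.Quotient.nontrivial_iff.2 hcomap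
  obtain ⟨i, hi1, hi2⟩ := Ideal.exists_coeff_mem_comap_sdiff_comap_of_root_mem_sdiff
    (I := P) (J := P ⊔ Ideal.span {g}) le_sup_left
    ⟨Ideal.mem_sup_right (Ideal.mem_span_singleton_self g), hg⟩ (hp.map _).ne_zero hpP
  obtain ⟨c, hc, d, hd, hcd⟩ := Submodule.mem_sup.1 (Ideal.mem_comap.1 hi1)
  obtain ⟨b, rfl⟩ := Ideal.mem_span_singleton'.1 hd
  exact ⟨p.coeff i, b, c, hi2, hc, hcd.symm⟩

/-- A prime ideal which contains a Weierstrass polynomial has enough zeros if its trace on the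
germs in one variable less has enough zeros: these lift by elimination theory. -/
theorem IsWeierstrass.hasEnoughZeros {W : (OGerm E)[X]} (hW : IsWeierstrass W)
    {P : Ideal (OGerm (E × ℂ))} [P.IsPrime] (hWP : Polynomial.aeval (lastCoord E) W ∈ P)
    (hP : HasEnoughZeros (P.comap (algebraMap (OGerm E) (OGerm (E × ℂ))))) :
    HasEnoughZeros P := by
  intro m h hh g hg
  obtain ⟨V, hVW, hVdeg, hVm, hV0⟩ := hW.exists_lift
  have hVP : toGerm (polyFun V) ∈ P := by rwa [← aeval_lastCoord, hVW]
  have hk : V.natDegree ≠ 0 := by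
    intro h0
    rw [hVm.natDegree_eq_zero.1 h0] at hVW
    refine Ideal.IsPrime.ne_top' ((Ideal.eq_top_iff_one P).2 ?_)
    simpa [← hVW] using hWP
  obtain ⟨a, b, c, haP, hcP, habc⟩ := hW.exists_multiple_notMem hWP hg
  obtain ⟨a, rfl⟩ := toGerm_surjective a
  obtain ⟨b, rfl⟩ := toGerm_surjective b
  obtain ⟨c, rfl⟩ := toGerm_surjective c
  -- The error term `c` joins the family of functions whose zeros are sought.
  let h' : Fin (m + 1) → FunAt (E × ℂ) := Fin.cons c h
  have hh' : ∀ i, toGerm (h' i) ∈ P := Fin.cases hcP hh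
  have hdiv (i : Fin (m + 1)) : ∃ (q : FunAt (E × ℂ)) (r : (FunAt E)[X]),
      r.natDegree ≤ V.natDegree ∧ toGerm (h' i) = toGerm (q * polyFun V + polyFun r) := by
    obtain ⟨q, r, hr, hqr⟩ := hW.exists_div (toGerm (h' i))
    obtain ⟨q, rfl⟩ := toGerm_surjective q
    obtain ⟨r, rfl, hrdeg⟩ := Polynomial.exists_degree_eq_of_mem_lifts
      (f := toGerm (E := E)) (p := r)
      ((Polynomial.lifts_iff_coeff_lifts _).2 fun _ => toGerm_surjective _)
    refine ⟨q, r, ?_, ?_⟩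
    · rw [hVdeg]
      exact Polynomial.natDegree_le_natDegree (hrdeg.trans_lt hr).le
    · rw [hqr, ← hVW, aeval_lastCoord, aeval_lastCoord, map_add, map_mul]
  choose q r hr hqr using hdiv
  have hrP (i : Fin (m + 1)) : toGerm (polyFun (r i)) ∈ P := by
    have h1 := hh' i
    rw [hqr, map_add, map_mul] at h1
    exact (Ideal.add_mem_iff_right P (P.mul_mem_left _ hVP)).1 h1
  obtain ⟨R, hRP, hR⟩ := exists_elimination hVm hk r hr
  have hfreq := hP (R.natDegree + 1) (fun j => R.coeff j) (fun j => hRP P hVP hrP j) a haP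
  have hev : ∀ᶠ x in 𝓝 (0 : E × ℂ),
      (∀ i, (h' i).1 x = (q i).1 x * (polyFun V).1 x + (polyFun (r i)).1 x) ∧
        a.1 x.1 = c.1 x + b.1 x * g.1 x := by
    refine (Filter.eventually_all.2 fun i => toGerm_eq_iff.1 (hqr i)).and ?_
    rw [algebraMap_toGerm, ← map_mul, ← map_add, toGerm_eq_iff] at habc
    exact habc
  rw [Filter.frequently_iff]
  intro U hU
  have hU' := hev.and hU
  rw [show (0 : E × ℂ) = (0, 0) from rfl, nhds_prod_eq] at hU'
  obtain ⟨p₁, hp₁, p₂, hp₂, hall⟩ := Filter.eventually_prod_iff.1 hU'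
  obtain ⟨ε, hε, hball⟩ := Metric.eventually_nhds_iff_ball.1 hp₂
  obtain ⟨y, ⟨hyR, hya⟩, hy₁, hroots⟩ :=
    (hfreq.and_eventually (hp₁.and (eventually_roots_small hVm hV0 hε))).exists
  obtain ⟨z, hz, hrz⟩ := hR y fun j => by
    rcases lt_or_ge j (R.natDegree + 1) with hj | hj
    · exact hyR ⟨j, hj⟩
    · rw [Polynomial.coeff_eq_zero_of_natDegree_lt hj]
      rfl
  have hVz : (V.map (evalAt y)).eval z = 0 := Polynomial.isRoot_of_mem_roots hz
  obtain ⟨⟨h1, h2⟩, hxU⟩ := hall hy₁ (hball z (mem_ball_zero_iff.2 (hroots z hVz)))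
  have hzero (i : Fin (m + 1)) : (h' i).1 (y, z) = 0 := by
    rw [h1 i, polyFun_apply, polyFun_apply, hVz, hrz i, mul_zero, add_zero]
  refine ⟨(y, z), hxU, fun i => hzero i.succ, fun hgz => hya ?_⟩
  have hc0 : c.1 (y, z) = 0 := hzero 0
  have h3 : a.1 y = c.1 (y, z) + b.1 (y, z) * g.1 (y, z) := h2
  rw [h3, hc0, hgz, mul_zero, add_zero]

theorem hasEnoughZeros_of_isPrime (n : ℕ) (P : Ideal (OGerm (Fin n → ℂ))) [hP : P.IsPrime] :
    HasEnoughZeros P := by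
  induction n with
  | zero =>
    have : P = ⊥ := by
      by_contra hne
      obtain ⟨φ, hφP, hφ⟩ := Submodule.exists_mem_ne_zero_of_ne_bot hne
      obtain ⟨ψ, hψ⟩ := (isField_oGerm_of_subsingleton (E := Fin 0 → ℂ)).mul_inv_cancel hφ
      exact hP.ne_top ((Ideal.eq_top_iff_one P).2 (hψ ▸ P.mul_mem_right ψ hφP))
    rw [this]
    exact hasEnoughZeros_bot
  | succ n ih =>
    refine HasEnoughZeros.of_equiv (prodEquivFin n) ?_
    set Q := P.comap (germEquiv (prodEquivFin n)).symm.toRingHom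
    by_cases hQ : Q = ⊥
    · rw [hQ]
      exact hasEnoughZeros_bot
    obtain ⟨φ, hφQ, hφ⟩ := Submodule.exists_mem_ne_zero_of_ne_bot hQ
    obtain ⟨L, W, hW, hassoc⟩ := exists_equiv_weierstrass hφ
    refine HasEnoughZeros.of_equiv L (hW.hasEnoughZeros ?_ (ih _))
    rw [Ideal.mem_iff_of_associated hassoc, Ideal.mem_comap]
    change (germEquiv L).symm (germEquiv L φ) ∈ Q
    rwa [RingEquiv.symm_apply_apply]

/-- **Rückert's Nullstellensatz**. -/
theorem mem_radical_of_vanishing {n m : ℕ} (h : Fin m → FunAt (Fin n → ℂ)) (g : FunAt (Fin n → ℂ))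
    (hg : ∀ᶠ x in 𝓝 0, (∀ i, (h i).1 x = 0) → g.1 x = 0) :
    toGerm g ∈ (Ideal.span (Set.range fun i => toGerm (h i))).radical := by
  rw [Ideal.radical_eq_sInf, Ideal.mem_sInf]
  rintro P ⟨hle, hP⟩
  by_contra hgP
  have h1 := hasEnoughZeros_of_isPrime n P m h
    (fun i => hle (Ideal.subset_span (Set.mem_range_self i))) g hgP
  obtain ⟨x, ⟨h2, h3⟩, h4⟩ := (h1.and_eventually hg).exists
  exact h3 (h4 h2)

end Nullstellensatz

/-! ### Operators on `𝓛` and the functional equation -/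

section Meromorphic

variable {n : ℕ} {p : Fin n → ℂ} (F G : HolGerm n p)

theorem meroPartial_algebraMap (i : Fin n) (a : HolGerm n p) :
    meroPartial F G i (algebraMap _ (Mero F G) a) = algebraMap _ (Mero F G) (germPartial n p i a) :=
  locDerivation_algebraMap _ _ a

theorem fMero_mul_G : fMero F G * algebraMap _ (Mero F G) G = algebraMap _ (Mero F G) F := by
  rw [fMero, mul_assoc, mul_comm (invG F G), G_mul_invG, mul_one]

/-- The quotient rule for `f = F / G`. -/
theorem G_sq_mul_meroPartial_fMero (i : Fin n) :
    algebraMap _ (Mero F G) G ^ 2 * meroPartial F G i (fMero F G) =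
      algebraMap _ (Mero F G) (G * germPartial n p i F - F * germPartial n p i G) := by
  have h := congrArg (meroPartial F G i) (fMero_mul_G F G)
  rw [Derivation.leibniz, meroPartial_algebraMap, meroPartial_algebraMap, smul_eq_mul,
    smul_eq_mul] at h
  rw [map_sub, map_mul, map_mul, ← fMero_mul_G F G, ← h]
  ring

theorem opMul_mem_DTilde (g : HolGerm n p) : opMul F G (algebraMap _ _ g) ∈ DTilde F G :=
  Algebra.subset_adjoin (Or.inl (Or.inl ⟨g, rfl⟩))

theorem opMul_invG_mem_DTilde : opMul F G (invG F G) ∈ DTilde F G :=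
  Algebra.subset_adjoin (Or.inl (Or.inr rfl))

theorem opPartial_mem_DTilde (i : Fin n) : opPartial F G i ∈ DTilde F G :=
  Algebra.subset_adjoin (Or.inr ⟨i, rfl⟩)

theorem opMul_mul (a b : Mero F G) : opMul F G (a * b) = opMul F G a * opMul F G b := by
  ext1 u
  simp [opMul]

theorem opMul_pow (a : Mero F G) (k : ℕ) : opMul F G (a ^ k) = opMul F G a ^ k := by
  induction k with
  | zero => ext1 u; simp [opMul]
  | succ k ih => rw [pow_succ, pow_succ, opMul_mul, ih]

theorem opMul_toL (g : Mero F G) (a : (Mero F G)[X]) :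
    opMul F G g (toL F G a) = toL F G (Polynomial.C g * a) := rfl

theorem opMul_toL_C (a b : Mero F G) :
    opMul F G a (toL F G (Polynomial.C b)) = toL F G (Polynomial.C (a * b)) := by
  rw [opMul_toL, Polynomial.C_mul]

theorem opS_toL (a : (Mero F G)[X]) : opS F G (toL F G a) = toL F G (Polynomial.X * a) := rfl

theorem opPartial_toL (i : Fin n) (a : (Mero F G)[X]) :
    opPartial F G i (toL F G a) = toL F G (coeffDeriv (meroPartial F G i) a + Polynomial.X *
      Polynomial.C (meroPartial F G i (fMero F G) * invf F G) * a) := rfl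

theorem coeffDeriv_C {B : Type} [CommRing B] [Algebra ℂ B] (δ : Derivation ℂ B B) (b : B) :
    coeffDeriv δ (Polynomial.C b) = Polynomial.C (δ b) := by
  ext k
  rw [coeff_coeffDeriv, Polynomial.coeff_C, Polynomial.coeff_C]
  split_ifs <;> simp

/-- The partial derivatives of `f` generate the unit ideal of `𝒪[1/G]` if a power of `G` lies in the
ideal generated by the numerators `G ∂ᵢF - F ∂ᵢG`. -/
theorem exists_sum_mul_meroPartial_eq_one {N : ℕ} {a : Fin n → HolGerm n p}
    (h : G ^ N = ∑ i, a i * (G * germPartial n p i F - F * germPartial n p i G)) :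
    ∃ c : Fin n → Mero F G, (∀ i, opMul F G (c i) ∈ DTilde F G) ∧
      ∑ i, c i * meroPartial F G i (fMero F G) = 1 := by
  refine ⟨fun i => invG F G ^ N * algebraMap _ _ (a i * G ^ 2), fun i => ?_, ?_⟩
  · rw [opMul_mul, opMul_pow]
    exact mul_mem (pow_mem (opMul_invG_mem_DTilde F G) N) (opMul_mem_DTilde F G _)
  · have h1 := congrArg (algebraMap (HolGerm n p) (Mero F G)) h
    calc ∑ i, invG F G ^ N * algebraMap _ (Mero F G) (a i * G ^ 2) * meroPartial F G i (fMero F G)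
        = invG F G ^ N * algebraMap _ (Mero F G)
            (∑ i, a i * (G * germPartial n p i F - F * germPartial n p i G)) := by
          rw [map_sum, Finset.mul_sum]
          refine Finset.sum_congr rfl fun i _ => ?_
          rw [map_mul, map_mul, map_pow, ← G_sq_mul_meroPartial_fMero]
          ring
      _ = 1 := by
          rw [← h, map_pow, ← mul_pow, mul_comm (invG F G), G_mul_invG, one_pow]

theorem subsingleton_RTilde {c : Fin n → Mero F G} (hc : ∀ i, opMul F G (c i) ∈ DTilde F G)
    (h : ∑ i, c i * meroPartial F G i (fMero F G) = 1) : Subsingleton (RTilde F G) := by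
  rw [Submodule.Quotient.subsingleton_iff, Submodule.submoduleOf,
    Submodule.comap_subtype_eq_top, DTildeFs, Submodule.span_singleton_le_iff_mem]
  have h1 : sectionL F G 0 0 = ∑ i, (⟨opMul F G (c i), hc i⟩ : DTilde F G) •
      opMul F G (meroPartial F G i (fMero F G)) (sectionL F G 0 0) := by
    have h2 (i : Fin n) : (⟨opMul F G (c i), hc i⟩ : DTilde F G) •
        opMul F G (meroPartial F G i (fMero F G)) (sectionL F G 0 0) =
        toL F G (Polynomial.C (c i * meroPartial F G i (fMero F G))) := by
      change opMul F G (c i) (opMul F G (meroPartial F G i (fMero F G)) (sectionL F G 0 0)) = _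
      rw [sectionL, opMul_toL_C, opMul_toL_C, pow_zero, pow_zero, mul_one, mul_one]
    rw [Finset.sum_congr rfl fun i _ => h2 i, ← map_sum, ← map_sum, h, sectionL, pow_zero,
      pow_zero, mul_one]
  rw [h1]
  exact sum_mem fun i _ => Submodule.smul_mem _ _ (Submodule.subset_span ⟨i, rfl⟩)

/-- From `∑ cᵢ ∂ᵢf = 1` one gets `∑ cᵢ ∂ᵢ f^{s+1} = (s + 1) f^s`, and conjugation with `G ^ m` gives
the functional equation of order `m`. -/
theorem reducedFunctionalEq_X_add_one {c : Fin n → Mero F G}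
    (hc : ∀ i, opMul F G (c i) ∈ DTilde F G)
    (h : ∑ i, c i * meroPartial F G i (fMero F G) = 1) (m : ℕ) :
    ReducedFunctionalEq F G m (Polynomial.X + 1) := by
  refine ⟨opMul F G (invG F G ^ m) * (∑ i, opMul F G (c i) * opPartial F G i) *
    opMul F G (algebraMap _ _ G ^ m), ?_, ?_⟩
  · refine (le_sup_left : DTilde F G ≤ DTildeS F G) (mul_mem (mul_mem ?_ ?_) ?_)
    · rw [opMul_pow]
      exact pow_mem (opMul_invG_mem_DTilde F G) m
    · exact sum_mem fun i _ => mul_mem (hc i) (opPartial_mem_DTilde F G i)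
    · rw [opMul_pow]
      exact pow_mem (opMul_mem_DTilde F G G) m
  · have h1 : opMul F G (algebraMap _ _ G ^ m) (sectionL F G m 1) =
        toL F G (Polynomial.C (fMero F G)) := by
      rw [sectionL, opMul_toL_C, mul_left_comm, ← mul_pow, G_mul_invG, one_pow, mul_one, pow_one]
    have h2 (i : Fin n) : (opMul F G (c i) * opPartial F G i) (toL F G (Polynomial.C (fMero F G))) =
        toL F G ((Polynomial.X + 1) * Polynomial.C (c i * meroPartial F G i (fMero F G))) := by
      have h3 : meroPartial F G i (fMero F G) * invf F G * fMero F G =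
          meroPartial F G i (fMero F G) := by
        rw [mul_assoc, mul_comm (invf F G), f_mul_invf, mul_one]
      rw [Module.End.mul_apply, opPartial_toL, coeffDeriv_C, mul_assoc, ← Polynomial.C_mul, h3,
        opMul_toL, Polynomial.C_mul]
      congr 1
      ring
    rw [Module.End.mul_apply, Module.End.mul_apply, h1, LinearMap.sum_apply,
      Finset.sum_congr rfl fun i _ => h2 i, ← map_sum, ← Finset.mul_sum, ← map_sum, h, map_one,
      mul_one, opMul_toL, map_add, map_one, Polynomial.aeval_X, LinearMap.add_apply,
      Module.End.one_apply, sectionL, opS_toL, ← map_add, pow_zero, one_mul]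
    congr 1
    ring

/-- The elements of `𝒪[1/(FG)]` which lie in `𝒪[1/G]`. -/
def polesG : Subalgebra ℂ (Mero F G) where
  carrier := {x | ∃ (N : ℕ) (a : HolGerm n p), x * algebraMap _ _ G ^ N = algebraMap _ _ a}
  mul_mem' := by
    rintro x y ⟨N, a, ha⟩ ⟨K, b, hb⟩
    refine ⟨N + K, a * b, ?_⟩
    rw [map_mul, ← ha, ← hb, pow_add]
    ring
  add_mem' := by
    rintro x y ⟨N, a, ha⟩ ⟨K, b, hb⟩
    refine ⟨N + K, a * G ^ K + b * G ^ N, ?_⟩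
    rw [map_add, map_mul, map_mul, ← ha, ← hb, pow_add, map_pow, map_pow]
    ring
  algebraMap_mem' r := ⟨0, algebraMap ℂ _ r, by
    rw [pow_zero, mul_one, ← IsScalarTower.algebraMap_apply]⟩

theorem algebraMap_mem_polesG (a : HolGerm n p) : algebraMap _ _ a ∈ polesG F G :=
  ⟨0, a, by rw [pow_zero, mul_one]⟩

theorem invG_mem_polesG : invG F G ∈ polesG F G :=
  ⟨1, 1, by rw [pow_one, mul_comm, G_mul_invG, map_one]⟩

theorem meroPartial_mem_polesG (i : Fin n) {x : Mero F G} (hx : x ∈ polesG F G) :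
    meroPartial F G i x ∈ polesG F G := by
  obtain ⟨N, a, ha⟩ := hx
  refine ⟨N + 1, germPartial n p i (a * G) - (N + 1 : ℕ) • (a * germPartial n p i G), ?_⟩
  have h1 : x * algebraMap _ _ G ^ (N + 1) = algebraMap _ _ (a * G) := by
    rw [map_mul, ← ha, pow_succ, mul_assoc]
  have h2 := congrArg (meroPartial F G i) h1
  rw [Derivation.leibniz, Derivation.leibniz_pow, meroPartial_algebraMap,
    meroPartial_algebraMap] at h2
  rw [map_sub, ← h2, map_nsmul, map_mul, ← ha]
  simp only [smul_eq_mul, nsmul_eq_mul, Nat.add_sub_cancel]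
  ring

/-- Specialization at `s = -1` of an element `a(s) f^s`, as the coefficient `a(-1)` of `f⁻¹`. -/
def evalNegOne : LMod F G →ₗ[ℂ] Mero F G :=
  ((Polynomial.aeval (-1 : Mero F G)).toLinearMap.restrictScalars ℂ) ∘ₗ (toL F G).symm.toLinearMap

theorem evalNegOne_toL (a : (Mero F G)[X]) : evalNegOne F G (toL F G a) = a.eval (-1) := by
  change Polynomial.aeval (-1 : Mero F G) a = _
  rw [Polynomial.coe_aeval_eq_eval]

theorem eval_coeffDeriv {B : Type} [CommRing B] [Algebra ℂ B] (δ : Derivation ℂ B B) (a : B[X]) :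
    (coeffDeriv δ a).eval (-1) = δ (a.eval (-1)) := by
  induction a using Polynomial.induction_on' with
  | add a b ha hb => rw [map_add, Polynomial.eval_add, ha, hb, Polynomial.eval_add, map_add]
  | monomial k c =>
    have h1 : coeffDeriv δ (Polynomial.monomial k c) = Polynomial.monomial k (δ c) := by
      ext j
      rw [coeff_coeffDeriv, Polynomial.coeff_monomial, Polynomial.coeff_monomial]
      split_ifs <;> simp
    have h2 : δ (-1) = 0 := by rw [map_neg, Derivation.map_one_eq_zero, neg_zero]
    rw [h1, Polynomial.eval_monomial, Polynomial.eval_monomial, Derivation.leibniz,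
      Derivation.leibniz_pow, h2]
    simp [mul_comm]

/-- The elements `a(s) f^s` of `𝓛` for which `a(-1) f⁻¹` lies in `𝒪[1/G]`. -/
def regularAtNegOne : Submodule ℂ (LMod F G) where
  carrier := {u | ∃ x ∈ polesG F G, evalNegOne F G u = fMero F G * x}
  add_mem' := by
    rintro u v ⟨x, hx, hu⟩ ⟨y, hy, hv⟩
    exact ⟨x + y, add_mem hx hy, by rw [map_add, hu, hv, mul_add]⟩
  zero_mem' := ⟨0, zero_mem _, by rw [map_zero, mul_zero]⟩
  smul_mem' := by
    rintro c u ⟨x, hx, hu⟩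
    exact ⟨c • x, (polesG F G).smul_mem hx c, by rw [map_smul, hu, mul_smul_comm]⟩

/-- Upon the substitution `s = -1`, the operators in `𝒟̃[s]` act on `𝒪[1/(FG)]` as elements of `𝒟̃`,
which preserve `𝒪[1/G]`. -/
theorem DTildeS_preserves {P : Module.End ℂ (LMod F G)} (hP : P ∈ DTildeS F G) {u : LMod F G}
    (hu : u ∈ regularAtNegOne F G) : P u ∈ regularAtNegOne F G := by
  let S : Subalgebra ℂ (Module.End ℂ (LMod F G)) :=
    { carrier := {T | ∀ u ∈ regularAtNegOne F G, T u ∈ regularAtNegOne F G}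
      mul_mem' := fun {A B} hA hB u hu => hA _ (hB u hu)
      add_mem' := fun {A B} hA hB u hu => add_mem (hA u hu) (hB u hu)
      algebraMap_mem' := fun r u hu => (regularAtNegOne F G).smul_mem r hu }
  have hmul (g : Mero F G) (hg : g ∈ polesG F G) : opMul F G g ∈ S := by
    rintro u ⟨x, hx, hu⟩
    obtain ⟨a, rfl⟩ := (toL F G).surjective u
    refine ⟨g * x, mul_mem hg hx, ?_⟩
    rw [evalNegOne_toL] at hu
    rw [opMul_toL, evalNegOne_toL, Polynomial.eval_mul,
      Polynomial.eval_C, hu, mul_left_comm]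
  have hle : DTildeS F G ≤ S := by
    refine sup_le (Algebra.adjoin_le ?_) (Algebra.adjoin_le ?_)
    · rintro _ ((⟨g, rfl⟩ | rfl) | ⟨i, rfl⟩)
      · exact hmul _ (algebraMap_mem_polesG F G g)
      · exact hmul _ (invG_mem_polesG F G)
      · rintro u ⟨x, hx, hu⟩
        obtain ⟨a, rfl⟩ := (toL F G).surjective u
        refine ⟨meroPartial F G i x, meroPartial_mem_polesG F G i hx, ?_⟩
        rw [evalNegOne_toL] at hu
        rw [opPartial_toL, evalNegOne_toL, Polynomial.eval_add, eval_coeffDeriv,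
          Polynomial.eval_mul, Polynomial.eval_mul, Polynomial.eval_X, Polynomial.eval_C, hu,
          Derivation.leibniz, smul_eq_mul, smul_eq_mul]
        linear_combination
          (-(meroPartial F G i (fMero F G) * x)) * f_mul_invf F G
    · rintro _ rfl u ⟨x, hx, hu⟩
      obtain ⟨a, rfl⟩ := (toL F G).surjective u
      refine ⟨-x, neg_mem hx, ?_⟩
      rw [evalNegOne_toL] at hu
      rw [opS_toL, evalNegOne_toL, Polynomial.eval_mul,
        Polynomial.eval_X, hu]
      ring
  exact hle hP u hu

theorem evalNegOne_aeval_opS (b : ℂ[X]) (u : LMod F G) :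
    evalNegOne F G (Polynomial.aeval (opS F G) b u) = b.eval (-1) • evalNegOne F G u := by
  have hS (v : LMod F G) : evalNegOne F G (opS F G v) = -evalNegOne F G v := by
    obtain ⟨a, rfl⟩ := (toL F G).surjective v
    rw [opS_toL, evalNegOne_toL, evalNegOne_toL,
      Polynomial.eval_mul, Polynomial.eval_X, neg_one_mul]
  induction b using Polynomial.induction_on with
  | C c => simp
  | add a b ha hb =>
    rw [map_add, LinearMap.add_apply, map_add, ha, hb, Polynomial.eval_add, add_smul]
  | monomial k c ih =>
    rw [pow_succ', mul_left_comm, map_mul, Module.End.mul_apply, Polynomial.aeval_X, hS, ih,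
      Polynomial.eval_mul (p := Polynomial.X), Polynomial.eval_X, neg_one_mul, neg_smul]

/-- If `f⁻¹` does not lie in `𝒪[1/G]`, then `-1` is a root of every polynomial which satisfies the
functional equation. -/
theorem eval_neg_one_eq_zero [IsDomain (HolGerm n p)] (hF : F ≠ 0) (hG : G ≠ 0)
    (hFG : ∀ N, ¬ F ∣ G ^ N) {m : ℕ} {b : ℂ[X]} (hb : ReducedFunctionalEq F G m b) :
    b.eval (-1) = 0 := by
  by_contra hne
  obtain ⟨P, hP, hbP⟩ := hb
  have h1 : sectionL F G m 1 ∈ regularAtNegOne F G := by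
    refine ⟨invG F G ^ m, pow_mem (invG_mem_polesG F G) m, ?_⟩
    rw [sectionL, evalNegOne_toL, Polynomial.eval_C, pow_one]
  obtain ⟨x, hx, hx'⟩ := DTildeS_preserves F G hP h1
  rw [← hbP, evalNegOne_aeval_opS, sectionL, evalNegOne_toL, Polynomial.eval_C, pow_zero,
    one_mul] at hx'
  obtain ⟨N, a, ha⟩ := (polesG F G).smul_mem hx (b.eval (-1))⁻¹
  have hx'' : invG F G ^ m = fMero F G * ((b.eval (-1))⁻¹ • x) := by
    rw [mul_smul_comm, ← hx', smul_smul, inv_mul_cancel₀ hne, one_smul]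
  have hinj : Function.Injective (algebraMap (HolGerm n p) (Mero F G)) :=
    IsLocalization.injective (M := Submonoid.powers (F * G)) _
      (powers_le_nonZeroDivisors_of_noZeroDivisors (mul_ne_zero hF hG))
  refine hFG (N + 1) ⟨a * G ^ m, hinj ?_⟩
  have hGm : algebraMap _ (Mero F G) G ^ m * invG F G ^ m = 1 := by
    rw [← mul_pow, G_mul_invG, one_pow]
  rw [map_mul, map_mul, ← ha, map_pow, map_pow, ← fMero_mul_G F G]
  rw [hx''] at hGm
  linear_combination (-(algebraMap _ (Mero F G) G ^ (N + 1))) * hGm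

theorem isReducedBFunction_iff_eq_X_add_one {m : ℕ}
    (h : ReducedFunctionalEq F G m (Polynomial.X + 1))
    (hroot : ∀ b, ReducedFunctionalEq F G m b → b.eval (-1) = 0) (b : ℂ[X]) :
    IsReducedBFunction F G m b ↔ b = Polynomial.X + 1 := by
  have hX : (Polynomial.X + 1 : ℂ[X]) = Polynomial.X - Polynomial.C (-1) := by simp
  have hdegX : (Polynomial.X + 1 : ℂ[X]).natDegree = 1 := by
    rw [hX, Polynomial.natDegree_X_sub_C]
  have hmonX : (Polynomial.X + 1 : ℂ[X]).Monic := by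
    rw [hX]
    exact Polynomial.monic_X_sub_C _
  constructor
  · rintro ⟨hmon, hb, hmin⟩
    have hdvd : Polynomial.X + 1 ∣ b := by
      rw [hX]
      exact Polynomial.dvd_iff_isRoot.2 (hroot b hb)
    exact (Polynomial.eq_of_monic_of_dvd_of_natDegree_le hmonX hmon hdvd
      (hmin _ hmonX.ne_zero h))
  · rintro rfl
    refine ⟨hmonX, h, fun c hc hceq => ?_⟩
    rw [hdegX]
    have hdvd : Polynomial.X - Polynomial.C (-1) ∣ c :=
      Polynomial.dvd_iff_isRoot.2 (hroot c hceq)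
    rw [← Polynomial.natDegree_X_sub_C (-1 : ℂ)]
    exact Polynomial.natDegree_le_of_dvd hdvd hc

end Meromorphic

/-! ### Quasi-homogeneous quotients -/

section Application

variable {n : ℕ}

/-- Rückert's Nullstellensatz at an arbitrary point. -/
theorem exists_pow_eq_sum_of_vanishing {p : Fin n → ℂ} {m : ℕ}
    (h : Fin m → (Fin n → ℂ) → ℂ) (hh : ∀ i, AnalyticAt ℂ (h i) p)
    (g : (Fin n → ℂ) → ℂ) (hg : AnalyticAt ℂ g p)
    (hgh : ∀ᶠ x in 𝓝 p, (∀ i, h i x = 0) → g x = 0) :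
    ∃ (N : ℕ) (a : Fin m → HolGerm n p), germAt g hg ^ N = ∑ i, a i * germAt (h i) (hh i) := by
  have htr {f : (Fin n → ℂ) → ℂ} (hf : AnalyticAt ℂ f p) :
      AnalyticAt ℂ (fun x => f (p + x)) 0 :=
    hf.comp_of_eq (analyticAt_const.add analyticAt_id) (add_zero p)
  have hadd : Filter.Tendsto (fun x => p + x) (𝓝 0) (𝓝 p) :=
    (continuous_const.add continuous_id).tendsto' 0 p (add_zero p)
  obtain ⟨N, hN⟩ := mem_radical_of_vanishing (fun i => ⟨fun x => h i (p + x), htr (hh i)⟩)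
    ⟨fun x => g (p + x), htr hg⟩ (hadd.eventually hgh)
  obtain ⟨c, hc⟩ := Ideal.mem_span_range_iff_exists_fun.1 hN
  choose b hb using fun i => toGerm_surjective (c i)
  have hsub {f : (Fin n → ℂ) → ℂ} (hf : AnalyticAt ℂ f 0) :
      AnalyticAt ℂ (fun x => f (x - p)) p :=
    hf.comp_of_eq (analyticAt_id.sub analyticAt_const) (sub_self p)
  refine ⟨N, fun i => germAt (fun x => (b i).1 (x - p)) (hsub (b i).2), ?_⟩
  simp only [← hb, ← map_mul, ← map_sum, ← map_pow] at hc
  rw [toGerm_eq_iff] at hc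
  have hs : Filter.Tendsto (fun x => x - p) (𝓝 p) (𝓝 0) :=
    (continuous_id.sub continuous_const).tendsto' p 0 (sub_self p)
  have hsum : AnalyticAt ℂ (fun x => ∑ i, (b i).1 (x - p) * h i x) p :=
    Finset.univ.analyticAt_fun_sum fun i _ => (hsub (b i).2).mul (hh i)
  have e1 : ∑ i, germAt (fun x => (b i).1 (x - p)) (hsub (b i).2) * germAt (h i) (hh i) =
      germAt _ hsum := by
    refine Subtype.ext ?_
    rw [AddSubmonoidClass.coe_finsetSum]
    change ∑ i, ((fun x => (b i).1 (x - p) * h i x : (Fin n → ℂ) → ℂ) :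
      Filter.Germ (𝓝 p) ℂ) = _
    have := map_sum (Filter.Germ.coeRingHom (R := ℂ) (𝓝 p))
      (fun i => (fun x => (b i).1 (x - p) * h i x : (Fin n → ℂ) → ℂ)) Finset.univ
    refine this.symm.trans ?_
    change ((∑ i, fun x => (b i).1 (x - p) * h i x : (Fin n → ℂ) → ℂ) : Filter.Germ (𝓝 p) ℂ) = _
    congr 1
    ext x
    simp
  rw [e1]
  change germAt (g ^ N) (hg.pow N) = _
  refine germAt_congr _ _ ?_
  filter_upwards [hs.eventually hc] with x hx
  have h1 : ((∑ i, b i * ⟨fun x => h i (p + x), htr (hh i)⟩ : FunAt (Fin n → ℂ))).1 (x - p) =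
      ∑ i, (b i).1 (x - p) * h i x := by
    rw [← evalAt_apply, map_sum]
    refine Finset.sum_congr rfl fun i _ => ?_
    rw [map_mul, evalAt_apply, evalAt_apply]
    change (b i).1 (x - p) * h i (p + (x - p)) = _
    rw [add_sub_cancel]
  rw [← h1, hx]
  change g x ^ N = g (p + (x - p)) ^ N
  rw [add_sub_cancel]

theorem isDomain_holGerm_zero : IsDomain (HolGerm n 0) :=
  inferInstanceAs (IsDomain (OGerm (Fin n → ℂ)))

theorem uniqueFactorizationMonoid_holGerm_zero : UniqueFactorizationMonoid (HolGerm n 0) :=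
  (isNoetherianRing_and_uniqueFactorizationMonoid_oGerm n).2

theorem not_isUnit_germAt {p : Fin n → ℂ} {g : (Fin n → ℂ) → ℂ} (hg : AnalyticAt ℂ g p)
    (h0 : g p = 0) : ¬ IsUnit (germAt g hg) := by
  intro h
  let v : HolGerm n p →+* ℂ := Filter.Germ.valueRingHom.comp (HolGerm n p).subtype
  exact (h.map v).ne_zero h0

/-- Coprime germs of functions which vanish at the origin are nonzero, and the first divides no
power of the second. -/
theorem ne_zero_and_not_dvd_pow {F G : (Fin n → ℂ) → ℂ} (hF : AnalyticAt ℂ F 0)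
    (hG : AnalyticAt ℂ G 0) (hcop : IsRelPrime (germAt F hF) (germAt G hG)) (hF0 : F 0 = 0)
    (hG0 : G 0 = 0) :
    germAt F hF ≠ 0 ∧ germAt G hG ≠ 0 ∧ ∀ N, ¬ germAt F hF ∣ germAt G hG ^ N := by
  have hd := isDomain_holGerm_zero (n := n)
  have hu := uniqueFactorizationMonoid_holGerm_zero (n := n)
  have hFu := not_isUnit_germAt hF hF0
  have hGu := not_isUnit_germAt hG hG0
  refine ⟨fun h => hGu ?_, fun h => hFu ?_, fun N h => hFu ?_⟩
  · exact hcop (h ▸ dvd_zero _) dvd_rfl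
  · exact hcop dvd_rfl (h ▸ dvd_zero _)
  · exact hcop.pow_right dvd_rfl h

/-- For quasi-homogeneous `F` and `G` of different degrees, the common zeros of the numerators
`G ∂ᵢF - F ∂ᵢG` of the partial derivatives of `F / G` lie in `G = 0`, if `F / G` has no critical
zeros: by Euler's formula, `F G` vanishes at these points. -/
theorem eq_zero_of_numerators_eq_zero {F G : (Fin n → ℂ) → ℂ} {x : Fin n → ℂ}
    (hF : AnalyticAt ℂ F x) (hG : AnalyticAt ℂ G x) {w : Fin n → ℕ} {d₁ d₂ : ℕ} (hd : d₁ ≠ d₂)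
    (hvF : ∑ i, (w i : ℂ) * x i * partialDeriv i F x = d₁ * F x)
    (hvG : ∑ i, (w i : ℂ) * x i * partialDeriv i G x = d₂ * G x)
    (hsmooth : F x = 0 → G x ≠ 0 → fderiv ℂ (fun y => F y / G y) x ≠ 0)
    (h : ∀ i, G x * partialDeriv i F x - F x * partialDeriv i G x = 0) : G x = 0 := by
  by_contra hGx
  have h1 : ((d₁ : ℂ) - d₂) * (F x * G x) = 0 := by
    calc ((d₁ : ℂ) - d₂) * (F x * G x) = G x * (d₁ * F x) - F x * (d₂ * G x) := by ring
      _ = ∑ i, (w i : ℂ) * x i * (G x * partialDeriv i F x - F x * partialDeriv i G x) := by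
          rw [← hvF, ← hvG, Finset.mul_sum, Finset.mul_sum, ← Finset.sum_sub_distrib]
          exact Finset.sum_congr rfl fun i _ => by ring
      _ = 0 := Finset.sum_eq_zero fun i _ => by rw [h i, mul_zero]
  have hFx : F x = 0 := by
    have hd' : (d₁ : ℂ) - d₂ ≠ 0 := sub_ne_zero.2 (by exact_mod_cast hd)
    exact (mul_eq_zero.1 ((mul_eq_zero.1 h1).resolve_left hd')).resolve_right hGx
  have hdF : fderiv ℂ F x = 0 := by
    refine ContinuousLinearMap.coe_injective (LinearMap.pi_ext' fun i => LinearMap.ext_ring ?_)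
    have h2 := h i
    rw [hFx, zero_mul, sub_zero] at h2
    exact (mul_eq_zero.1 h2).resolve_left hGx
  refine hsmooth hFx hGx ?_
  have h3 := hF.differentiableAt.hasFDerivAt.mul (hG.inv hGx).differentiableAt.hasFDerivAt
  have h4 : (fun y => F y / G y) = F * G⁻¹ := by
    ext y
    exact div_eq_mul_inv _ _
  rw [h4, h3.fderiv, hFx, hdF]
  ext v
  change 0 * _ + _ * (0 : ℂ) = 0
  ring

end Application

end MeroBFun

end

theorem proposition4p4 {n : ℕ} {U : Set (Fin n → ℂ)} (hU : IsOpen U) (h0 : (0 : Fin n → ℂ) ∈ U)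
    {F G : (Fin n → ℂ) → ℂ} (hF : AnalyticOnNhd ℂ F U) (hG : AnalyticOnNhd ℂ G U)
    (hcop : IsRelPrime (MeroBFun.germAt F (hF 0 h0)) (MeroBFun.germAt G (hG 0 h0)))
    {w : Fin n → ℕ} (hw : w ≠ 0) {d₁ d₂ : ℕ} (hd₁ : 0 < d₁) (hd₂ : 0 < d₂) (hd : d₁ ≠ d₂)
    (hvF : ∀ x ∈ U, ∑ i, (w i : ℂ) * x i * MeroBFun.partialDeriv i F x = d₁ * F x)
    (hvG : ∀ x ∈ U, ∑ i, (w i : ℂ) * x i * MeroBFun.partialDeriv i G x = d₂ * G x)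
    (hsmooth : ∀ x ∈ U, F x = 0 → G x ≠ 0 → fderiv ℂ (fun y => F y / G y) x ≠ 0) :
    (∀ (p : Fin n → ℂ) (hp : p ∈ U),
      Subsingleton
        (MeroBFun.RTilde (MeroBFun.germAt F (hF p hp)) (MeroBFun.germAt G (hG p hp)))) ∧
    ∀ (m : ℕ) (b : Polynomial ℂ),
      MeroBFun.IsReducedBFunction (MeroBFun.germAt F (hF 0 h0)) (MeroBFun.germAt G (hG 0 h0)) m b ↔
        b = Polynomial.X + 1 := by
  have hunit (p : Fin n → ℂ) (hp : p ∈ U) :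
      ∃ c : Fin n → MeroBFun.Mero (MeroBFun.germAt F (hF p hp)) (MeroBFun.germAt G (hG p hp)),
        (∀ i, MeroBFun.opMul _ _ (c i) ∈ MeroBFun.DTilde _ _) ∧
          ∑ i, c i * MeroBFun.meroPartial _ _ i (MeroBFun.fMero _ _) = 1 := by
    obtain ⟨N, a, h⟩ := MeroBFun.exists_pow_eq_sum_of_vanishing
      (fun i x => G x * MeroBFun.partialDeriv i F x - F x * MeroBFun.partialDeriv i G x)
      (fun i => ((hG p hp).mul (MeroBFun.analyticAt_partialDeriv i (hF p hp))).sub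
        ((hF p hp).mul (MeroBFun.analyticAt_partialDeriv i (hG p hp)))) G (hG p hp) (by
      filter_upwards [hU.mem_nhds hp] with x hx
      exact MeroBFun.eq_zero_of_numerators_eq_zero (hF x hx) (hG x hx) hd (hvF x hx) (hvG x hx)
        (hsmooth x hx))
    exact MeroBFun.exists_sum_mul_meroPartial_eq_one _ _ h
  refine ⟨fun p hp => ?_, fun m b => ?_⟩
  · obtain ⟨c, hc, h⟩ := hunit p hp
    exact MeroBFun.subsingleton_RTilde _ _ hc h
  · obtain ⟨c, hc, h⟩ := hunit 0 h0
    have hF0 : F 0 = 0 := by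
      have h1 := hvF 0 h0
      simp only [Pi.zero_apply, mul_zero, zero_mul, Finset.sum_const_zero] at h1
      exact (mul_eq_zero.1 h1.symm).resolve_left (by exact_mod_cast hd₁.ne')
    have hG0 : G 0 = 0 := by
      have h1 := hvG 0 h0
      simp only [Pi.zero_apply, mul_zero, zero_mul, Finset.sum_const_zero] at h1
      exact (mul_eq_zero.1 h1.symm).resolve_left (by exact_mod_cast hd₂.ne')
    obtain ⟨hFne, hGne, hdvd⟩ := MeroBFun.ne_zero_and_not_dvd_pow _ _ hcop hF0 hG0
    have hdom := MeroBFun.isDomain_holGerm_zero (n := n)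
    exact MeroBFun.isReducedBFunction_iff_eq_X_add_one _ _
      (MeroBFun.reducedFunctionalEq_X_add_one _ _ hc h m)
      (fun b hb => MeroBFun.eval_neg_one_eq_zero _ _ hFne hGne hdvd hb) b
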